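/- Let $\mathrm{Lip}_0(\mathbb R)$ be the Banach space of Lipschitz functions $f:\mathbb R\to\mathbb R$ with $f(0)=0$, normed by the Lipschitz constant; let $\delta_x(f)=f(x)$, let $F(\mathbb R)$ be the closed linear span of $\{\delta_x : x\in\mathbb R\}$ in $\mathrm{Lip}_0(\mathbb R)^*$, and let $\beta_{\mathbb R}:F(\mathbb R)\to\mathbb R$ be the continuous linear map with $\beta_{\mathbb R}(\delta_x)=x$. Let $\hat\otimes_\pi$ denote the completed projective tensor product. Let $BLip_0(\mathbb R,\mathbb R;\mathbb R)$ be the space of all $T:\mathbb R\times\mathbb R\to\mathbb R$ with $T(x,0)=0=T(0,y)$ for which $$BLip(T)=\sup_{x\ne x',\,y\ne y'}\frac{|T(x,y)-T(x',y)-T(x,y')+T(x',y')|}{|x-x'|\,|y-y'|}<\infty ,$$ normed by $BLip(\cdot)$, and let $Blin(\mathbb R,\mathbb R;\mathbb R)$ be its subspace of bounded bilinear maps. All $L^p$-spaces are real and refer to Lebesgue measure. Put $$\mathcal D=\ker(\beta_{\mathbb R})\hat\otimes_\pi F(\mathbb R)+F(\mathbb R)\hat\otimes_\pi\ker(\beta_{\mathbb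 R})\subset F(\mathbb R)\hat\otimes_\pi F(\mathbb R),$$ the sum of the ranges of the two canonical maps into $F(\mathbb R)\hat\otimes_\pi F(\mathbb R)$, with the induced norm, and $$W_1=\Big\{f\in L^1(\mathbb R^2):\int_{\mathbb R} f(x,y)\,dx=0\text{ for a.e. }y\Big\},\qquad W_2=\Big\{f\in L^1(\mathbb R^2):\int_{\mathbb R} f(x,y)\,dy=0\text{ for a.e. }x\Big\}.$$ Then there are surjective linear isometries $\varphi,\Psi,L,J,\Theta,Q$ as follows. 1. $\varphi:F(\mathbb R)\to L^1(\mathbb R)$ satisfies $\varphi(\delta_x)=\chi_{(0,x)}$ for $x>0$, $\varphi(\delta_0)=0$, $\varphi(\delta_x)=-\chi_{(x,0)}$ for $x<0$, and $\varphi$ maps $\ker(\beta_{\mathbb R})$ onto $\{f\in L^1(\mathbb R):\int f\,dx=0\}$. 2. $\Psi:F(\mathbb R)\hat\otimes_\pi F(\mathbb R)\to L^1(\mathbb R^2)$ satisfies $\Psi(\mu\otimes\nu)(x,y)=\varphi(\mu)(x)\,\varphi(\nu)(y)$ for almost every $(x,y)$. 3. $L:BLip_0(\mathbb R,\mathbb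 R;\mathbb R)\to\big(F(\mathbb R)\hat\otimes_\pi F(\mathbb R)\big)^*$, $T\mapsto T_L$, satisfies $T_L(\delta_x\otimes\delta_y)=T(x,y)$, and $J:\big(F(\mathbb R)\hat\otimes_\pi F(\mathbb R)\big)^*\to L^\infty(\mathbb R\times\mathbb R)$ satisfies $\Lambda(\xi)=\int_{\mathbb R^2}J(\Lambda)\,\Psi(\xi)\,dx\,dy$ for all $\Lambda$ and $\xi$. The composition $J\circ L$ maps $Blin(\mathbb R,\mathbb R;\mathbb R)$ onto $\mathrm{span}\{\mathbf 1\}$. 4. $\Theta:BLip_0(\mathbb R,\mathbb R;\mathbb R)/Blin(\mathbb R,\mathbb R;\mathbb R)\to\mathcal D^*$ is given by $\Theta([T])(\xi)=T_L(\xi)$, and $$Q:L^\infty(\mathbb R\times\mathbb R)/\mathrm{span}\{\mathbf 1\}\to\mathcal D^*$$ is given by $Q([g])(\xi)=\int_{\mathbb R^2} g\,\Psi(\xi)\,dx\,dy$. In particular $L^\infty(\mathbb R\times\mathbb R)/\mathrm{span}\{\mathbf 1\}$ is isometrically isomorphic to the dual of $\mathcal D$. 5. The canonical maps $\ker(\beta_{\mathbb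 R})\hat\otimes_\pi F(\mathbb R)\to F(\mathbb R)\hat\otimes_\pi F(\mathbb R)$ and $F(\mathbb R)\hat\otimes_\pi\ker(\beta_{\mathbb R})\to F(\mathbb R)\hat\otimes_\pi F(\mathbb R)$ are isometric, and $\Psi$ maps their ranges onto $W_1$ and $W_2$ respectively; hence $\Psi$ maps $\mathcal D$ isometrically onto $W_1+W_2$. -/

import Mathlib

open MeasureTheory Set
open scoped TensorProduct ENNReal

noncomputable section

namespace TwoLip

universe u v w

/-! ## Lipschitz functions vanishing at the origin -/

/-- Real-valued Lipschitz functions on `X` that vanish at `0`, as a subspace of all functions. -/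
def lip0Submodule (X : Type u) [NormedAddCommGroup X] : Submodule ℝ (X → ℝ) where
  carrier := {f | (∃ k : ℝ, 0 ≤ k ∧ ∀ x x', |f x - f x'| ≤ k * ‖x - x'‖) ∧ f 0 = 0}
  zero_mem' := ⟨⟨0, le_rfl, by simp⟩, rfl⟩
  add_mem' := by
    rintro f g ⟨⟨k, hk, hf⟩, hf0⟩ ⟨⟨l, hl, hg⟩, hg0⟩
    refine ⟨⟨k + l, by positivity, fun x x' => ?_⟩, by simp [hf0, hg0]⟩
    calc |(f + g) x - (f + g) x'| = |(f x - f x') + (g x - g x')| := by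
          simp only [Pi.add_apply]; congr 1; ring
      _ ≤ |f x - f x'| + |g x - g x'| := abs_add_le _ _
      _ ≤ (k + l) * ‖x - x'‖ := by linarith [hf x x', hg x x']
  smul_mem' := by
    rintro c f ⟨⟨k, hk, hf⟩, hf0⟩
    refine ⟨⟨|c| * k, by positivity, fun x x' => ?_⟩, by simp [hf0]⟩
    calc |(c • f) x - (c • f) x'| = |c| * |f x - f x'| := by
          simp only [Pi.smul_apply, smul_eq_mul]; rw [← abs_mul]; congr 1; ring
      _ ≤ |c| * k * ‖x - x'‖ := by
          rw [mul_assoc]; exact mul_le_mul_of_nonneg_left (hf x x') (abs_nonneg c)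

/-- The space `Lip₀(X, ℝ)`. It is a type of its own so that it does not inherit the topology of
pointwise convergence. -/
def Lip0 (X : Type u) [NormedAddCommGroup X] : Type u := ↥(lip0Submodule X)

namespace Lip0

variable {X : Type u} [NormedAddCommGroup X]

instance : AddCommGroup (Lip0 X) := inferInstanceAs (AddCommGroup ↥(lip0Submodule X))
instance : Module ℝ (Lip0 X) := inferInstanceAs (Module ℝ ↥(lip0Submodule X))
instance : CoeFun (Lip0 X) (fun _ => X → ℝ) := ⟨fun f => f.1⟩

/-- The Lipschitz constant `sup |f x - f x'| / ‖x - x'‖`; a pair with `x = x'` contributes the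
value `0` and so does not change the supremum. -/
instance : Norm (Lip0 X) := ⟨fun f => ⨆ q : X × X, |f q.1 - f q.2| / ‖q.1 - q.2‖⟩

theorem add_apply (f g : Lip0 X) (x : X) : (f + g) x = f x + g x := rfl
theorem smul_apply (c : ℝ) (f : Lip0 X) (x : X) : (c • f) x = c * f x := rfl
theorem map_zero (f : Lip0 X) : f 0 = 0 := f.2.2

theorem norm_def (f : Lip0 X) : ‖f‖ = ⨆ q : X × X, |f q.1 - f q.2| / ‖q.1 - q.2‖ := rfl

theorem bddAbove (f : Lip0 X) :
    BddAbove (range fun q : X × X => |f q.1 - f q.2| / ‖q.1 - q.2‖) := by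
  obtain ⟨k, hk, hf⟩ := f.2.1
  refine ⟨k, ?_⟩
  rintro _ ⟨q, rfl⟩
  exact div_le_of_le_mul₀ (norm_nonneg _) hk (hf _ _)

theorem norm_nonneg' (f : Lip0 X) : 0 ≤ ‖f‖ :=
  Real.iSup_nonneg fun _ => by positivity

theorem le_norm (f : Lip0 X) (x x' : X) : |f x - f x'| ≤ ‖f‖ * ‖x - x'‖ := by
  rcases eq_or_ne x x' with rfl | h
  · simp
  · have hp : 0 < ‖x - x'‖ := norm_pos_iff.2 (sub_ne_zero.2 h)
    exact (div_le_iff₀ hp).1 (le_ciSup f.bddAbove (x, x'))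

theorem norm_le (f : Lip0 X) {k : ℝ} (hk : 0 ≤ k)
    (h : ∀ x x', |f x - f x'| ≤ k * ‖x - x'‖) : ‖f‖ ≤ k :=
  ciSup_le fun q => div_le_of_le_mul₀ (norm_nonneg _) hk (h q.1 q.2)

theorem norm_smul_le' (c : ℝ) (f : Lip0 X) : ‖c • f‖ ≤ |c| * ‖f‖ := by
  refine norm_le _ (mul_nonneg (abs_nonneg c) f.norm_nonneg') fun x x' => ?_
  rw [smul_apply, smul_apply, ← mul_sub, abs_mul, mul_assoc]
  exact mul_le_mul_of_nonneg_left (f.le_norm x x') (abs_nonneg c)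

theorem norm_add_le' (f g : Lip0 X) : ‖f + g‖ ≤ ‖f‖ + ‖g‖ := by
  refine norm_le _ (add_nonneg f.norm_nonneg' g.norm_nonneg') fun x x' => ?_
  calc |(f + g) x - (f + g) x'| = |(f x - f x') + (g x - g x')| := by
        rw [add_apply, add_apply]; congr 1; ring
    _ ≤ |f x - f x'| + |g x - g x'| := abs_add_le _ _
    _ ≤ (‖f‖ + ‖g‖) * ‖x - x'‖ := by linarith [f.le_norm x x', g.le_norm x x']

theorem eq_zero_of_norm (f : Lip0 X) (h : ‖f‖ = 0) : f = 0 := by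
  refine Subtype.ext (funext fun x => ?_)
  have := f.le_norm x 0
  rw [h, zero_mul, f.map_zero, sub_zero] at this
  exact abs_nonpos_iff.1 this

theorem core : NormedSpace.Core ℝ (Lip0 X) where
  norm_nonneg := norm_nonneg'
  norm_smul c f := by
    refine le_antisymm (norm_smul_le' c f) ?_
    rcases eq_or_ne c 0 with rfl | hc
    · simpa using norm_nonneg' ((0 : ℝ) • f)
    · have h := norm_smul_le' c⁻¹ (c • f)
      rw [inv_smul_smul₀ hc, abs_inv] at h
      rw [Real.norm_eq_abs]
      have hc' : 0 < |c| := abs_pos.2 hc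
      calc |c| * ‖f‖ ≤ |c| * (|c|⁻¹ * ‖c • f‖) := mul_le_mul_of_nonneg_left h hc'.le
        _ = ‖c • f‖ := by field_simp
  norm_triangle := norm_add_le'
  norm_eq_zero_iff f := by
    refine ⟨eq_zero_of_norm f, ?_⟩
    rintro rfl
    exact le_antisymm (by simpa using norm_smul_le' 0 (0 : Lip0 X)) (norm_nonneg' _)

instance : NormedAddCommGroup (Lip0 X) := NormedAddCommGroup.ofCore core
instance : NormedSpace ℝ (Lip0 X) := NormedSpace.ofCore core

/-- The evaluation functional `δ_x : f ↦ f x` on `Lip₀(X, ℝ)`. -/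
def eval (x : X) : StrongDual ℝ (Lip0 X) :=
  LinearMap.mkContinuous
    { toFun := fun f => f x
      map_add' := fun f g => add_apply f g x
      map_smul' := fun c f => smul_apply c f x } ‖x‖ fun f => by
    have := f.le_norm x 0
    rw [f.map_zero, sub_zero, sub_zero] at this
    rw [mul_comm]
    exact this

end Lip0

/-! ## The Lipschitz free space and the map `β` -/

/-- The closed linear span of the evaluation functionals in the dual of `Lip₀(X, ℝ)`. -/
def freeSubmodule (X : Type u) [NormedAddCommGroup X] : Submodule ℝ (StrongDual ℝ (Lip0 X)) :=
  (Submodule.span ℝ (range (Lip0.eval (X := X)))).topologicalClosure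

/-- The Lipschitz free space `F(X)`, with the norm of the dual of `Lip₀(X, ℝ)`. -/
def FreeSpace (X : Type u) [NormedAddCommGroup X] : Type u := ↥(freeSubmodule X)

instance (X : Type u) [NormedAddCommGroup X] : NormedAddCommGroup (FreeSpace X) :=
  inferInstanceAs (NormedAddCommGroup ↥(freeSubmodule X))

instance (X : Type u) [NormedAddCommGroup X] : NormedSpace ℝ (FreeSpace X) :=
  inferInstanceAs (NormedSpace ℝ ↥(freeSubmodule X))

/-- The isometric inclusion of `F(X)` in the dual of `Lip₀(X, ℝ)`. -/
def FreeSpace.incl (X : Type u) [NormedAddCommGroup X] :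
    FreeSpace X →ₗᵢ[ℝ] StrongDual ℝ (Lip0 X) :=
  (freeSubmodule X).subtypeₗᵢ

/-- The evaluation functional `δ_x` as an element of `F(X)`. -/
def delta {X : Type u} [NormedAddCommGroup X] (x : X) : FreeSpace X :=
  ⟨Lip0.eval x, Submodule.le_topologicalClosure _ (Submodule.subset_span (mem_range_self x))⟩

/-- The identity function of `ℝ` as an element of `Lip₀(ℝ, ℝ)`. -/
def idLip : Lip0 ℝ := ⟨fun x => x, ⟨1, zero_le_one, fun x x' => by simp⟩, rfl⟩

/-- The map `β_ℝ : F(ℝ) → ℝ`. Elements of `F(ℝ)` are functionals on `Lip₀(ℝ, ℝ)`, and `β_ℝ` is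
evaluation of such a functional at the identity function. It is the continuous linear map with
`β_ℝ (δ_x) = x`, and a contraction. -/
def beta : FreeSpace ℝ →L[ℝ] ℝ :=
  (ContinuousLinearMap.apply ℝ ℝ idLip).comp (FreeSpace.incl ℝ).toContinuousLinearMap

theorem beta_delta (x : ℝ) : beta (delta x) = x := rfl

theorem norm_beta_le (μ : FreeSpace ℝ) : ‖beta μ‖ ≤ ‖μ‖ := by
  have h1 : ‖idLip‖ ≤ 1 := Lip0.norm_le _ zero_le_one fun x x' => by
    simp [idLip]
  calc ‖beta μ‖ = ‖FreeSpace.incl ℝ μ idLip‖ := rfl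
    _ ≤ ‖FreeSpace.incl ℝ μ‖ * ‖idLip‖ := ContinuousLinearMap.le_opNorm _ _
    _ ≤ ‖FreeSpace.incl ℝ μ‖ * 1 := mul_le_mul_of_nonneg_left h1 (norm_nonneg _)
    _ = ‖μ‖ := by rw [mul_one, LinearIsometry.norm_map]

/-- `β_ℝ` is the only continuous linear map with `β_ℝ (δ_x) = x`. -/
theorem beta_unique (b : FreeSpace ℝ →L[ℝ] ℝ) (hb : ∀ x : ℝ, b (delta x) = x) : b = beta := by
  have hcl : IsClosed (freeSubmodule ℝ : Set (StrongDual ℝ (Lip0 ℝ))) :=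
    Submodule.isClosed_topologicalClosure _
  have hemb : Topology.IsClosedEmbedding (Subtype.val : FreeSpace ℝ → StrongDual ℝ (Lip0 ℝ)) :=
    hcl.isClosedEmbedding_subtypeVal
  have hle : freeSubmodule ℝ ≤ (LinearMap.ker (b - beta).toLinearMap).map
      (FreeSpace.incl ℝ).toLinearMap := by
    refine Submodule.topologicalClosure_minimal _ (Submodule.span_le.2 ?_) ?_
    · rintro _ ⟨x, rfl⟩
      refine ⟨delta x, ?_, rfl⟩
      change b (delta x) - beta (delta x) = 0
      rw [hb, beta_delta, sub_self]
    · exact hemb.isClosedMap _ (b - beta).isClosed_ker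
  ext μ
  obtain ⟨ν, hν, he⟩ := hle μ.2
  have hνμ : ν = μ := Subtype.ext he
  subst hνμ
  exact sub_eq_zero.1 hν

/-! ## The completed projective tensor product -/

/-- The algebraic tensor product of two real normed spaces, as a type of its own that carries the
projective norm. -/
def PTensor (E : Type u) (F : Type v) [NormedAddCommGroup E] [NormedSpace ℝ E]
    [NormedAddCommGroup F] [NormedSpace ℝ F] : Type (max u v) := E ⊗[ℝ] F

namespace PTensor

set_option linter.unusedSectionVars false

variable {E : Type u} {F : Type v} [NormedAddCommGroup E] [NormedSpace ℝ E]
  [NormedAddCommGroup F] [NormedSpace ℝ F]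

instance : AddCommGroup (PTensor E F) := inferInstanceAs (AddCommGroup (E ⊗[ℝ] F))
instance : Module ℝ (PTensor E F) := inferInstanceAs (Module ℝ (E ⊗[ℝ] F))

/-- The elementary tensor `x ⊗ y`. -/
def tmul (x : E) (y : F) : PTensor E F := (x ⊗ₜ[ℝ] y : E ⊗[ℝ] F)

/-- The tensor `∑ xᵢ ⊗ yᵢ` represented by a finite list of pairs `(xᵢ, yᵢ)`. -/
def listSum (l : List (E × F)) : PTensor E F := (l.map fun p => tmul p.1 p.2).sum

/-- The cost `∑ ‖xᵢ‖ ‖yᵢ‖` of a finite list of pairs `(xᵢ, yᵢ)`. -/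
def listCost (l : List (E × F)) : ℝ := (l.map fun p => ‖p.1‖ * ‖p.2‖).sum

/-- The projective norm: the infimum of `∑ ‖xᵢ‖ ‖yᵢ‖` over all representations
`u = ∑ xᵢ ⊗ yᵢ`. -/
instance : Norm (PTensor E F) :=
  ⟨fun t => sInf {r : ℝ | ∃ l : List (E × F), listSum l = t ∧ listCost l = r}⟩

theorem norm_def (t : PTensor E F) :
    ‖t‖ = sInf {r : ℝ | ∃ l : List (E × F), listSum l = t ∧ listCost l = r} := rfl

theorem listCost_nonneg (l : List (E × F)) : 0 ≤ listCost l :=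
  List.sum_nonneg fun r hr => by
    obtain ⟨p, -, rfl⟩ := List.mem_map.1 hr
    positivity

theorem norm_le_listCost (l : List (E × F)) : ‖(listSum l : PTensor E F)‖ ≤ listCost l :=
  csInf_le ⟨0, by rintro _ ⟨l, -, rfl⟩; exact listCost_nonneg l⟩ ⟨l, rfl, rfl⟩

theorem norm_nonneg' (t : PTensor E F) : 0 ≤ ‖t‖ :=
  Real.sInf_nonneg (by rintro _ ⟨l, -, rfl⟩; exact listCost_nonneg l)

theorem listSum_append (l m : List (E × F)) :
    (listSum (l ++ m) : PTensor E F) = listSum l + listSum m := by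
  simp [listSum]

theorem listCost_append (l m : List (E × F)) :
    listCost (l ++ m) = listCost l + listCost m := by
  simp [listCost]

theorem listSum_smul (c : ℝ) (l : List (E × F)) :
    (listSum (l.map fun p => (c • p.1, p.2)) : PTensor E F) = c • listSum l := by
  induction l with
  | nil => simp [listSum]
  | cons p l ih =>
      have h1 : (tmul (c • p.1) p.2 : PTensor E F) = c • tmul p.1 p.2 :=
        (TensorProduct.smul_tmul' c p.1 p.2).symm
      simp only [listSum, List.map_cons, List.sum_cons, smul_add, h1] at ih ⊢
      rw [ih]

theorem listCost_smul (c : ℝ) (l : List (E × F)) :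
    listCost (l.map fun p => (c • p.1, p.2)) = |c| * listCost l := by
  induction l with
  | nil => simp [listCost]
  | cons p l ih =>
      simp only [listCost, List.map_cons, List.sum_cons, norm_smul, Real.norm_eq_abs] at ih ⊢
      rw [ih]; ring

theorem exists_listSum (t : PTensor E F) : ∃ l : List (E × F), listSum l = t := by
  refine TensorProduct.induction_on (motive := fun t : E ⊗[ℝ] F =>
    ∃ l : List (E × F), (listSum l : PTensor E F) = t) t ⟨[], rfl⟩
    (fun x y => ⟨[(x, y)], add_zero (tmul x y)⟩) ?_
  rintro a b ⟨l, rfl⟩ ⟨m, rfl⟩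
  exact ⟨l ++ m, listSum_append l m⟩

theorem le_norm (t : PTensor E F) {r : ℝ}
    (h : ∀ l : List (E × F), listSum l = t → r ≤ listCost l) : r ≤ ‖t‖ := by
  obtain ⟨l, hl⟩ := exists_listSum t
  exact le_csInf ⟨_, l, hl, rfl⟩ (by rintro _ ⟨m, hm, rfl⟩; exact h m hm)

theorem norm_add_le' (s t : PTensor E F) : ‖s + t‖ ≤ ‖s‖ + ‖t‖ := by
  rw [← sub_le_iff_le_add']
  refine le_norm t fun m hm => ?_
  rw [sub_le_comm]
  refine le_norm s fun l hl => ?_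
  rw [sub_le_iff_le_add, ← listCost_append, ← hl, ← hm, ← listSum_append]
  exact norm_le_listCost _

theorem norm_smul_le' (c : ℝ) (t : PTensor E F) : ‖c • t‖ ≤ |c| * ‖t‖ := by
  rcases eq_or_ne c 0 with rfl | hc
  · have := norm_le_listCost ([] : List (E × F))
    simpa [listSum, listCost] using this
  · have hc' : 0 < |c| := abs_pos.2 hc
    rw [← div_le_iff₀' hc']
    refine le_norm t fun l hl => ?_
    rw [div_le_iff₀' hc', ← listCost_smul, ← hl, ← listSum_smul]
    exact norm_le_listCost _

theorem core : SeminormedSpace.Core ℝ (PTensor E F) where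
  norm_nonneg := norm_nonneg'
  norm_smul c t := by
    refine le_antisymm (norm_smul_le' c t) ?_
    rcases eq_or_ne c 0 with rfl | hc
    · simpa using norm_nonneg' ((0 : ℝ) • t)
    · have h := norm_smul_le' c⁻¹ (c • t)
      rw [inv_smul_smul₀ hc, abs_inv] at h
      rw [Real.norm_eq_abs]
      have hc' : 0 < |c| := abs_pos.2 hc
      calc |c| * ‖t‖ ≤ |c| * (|c|⁻¹ * ‖c • t‖) := mul_le_mul_of_nonneg_left h hc'.le
        _ = ‖c • t‖ := by field_simp
  norm_triangle := norm_add_le'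

instance : SeminormedAddCommGroup (PTensor E F) := SeminormedAddCommGroup.ofCore core
instance : NormedSpace ℝ (PTensor E F) where
  norm_smul_le := norm_smul_le'

variable {E' : Type w} [NormedAddCommGroup E'] [NormedSpace ℝ E']
  {F' : Type*} [NormedAddCommGroup F'] [NormedSpace ℝ F']

/-- The map `f ⊗ g` between tensor products with the projective norm. -/
def map (f : E →L[ℝ] E') (g : F →L[ℝ] F') : PTensor E F →L[ℝ] PTensor E' F' :=
  LinearMap.mkContinuous
    (show PTensor E F →ₗ[ℝ] PTensor E' F' from TensorProduct.map f.toLinearMap g.toLinearMap)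
    (‖f‖ * ‖g‖) fun t => by
      have hc : 0 ≤ ‖f‖ * ‖g‖ := by positivity
      have key : ∀ l : List (E × F),
          ‖(show PTensor E F →ₗ[ℝ] PTensor E' F' from
            TensorProduct.map f.toLinearMap g.toLinearMap) (listSum l)‖
            ≤ (‖f‖ * ‖g‖) * listCost l := by
        intro l
        have h1 : (show PTensor E F →ₗ[ℝ] PTensor E' F' from
            TensorProduct.map f.toLinearMap g.toLinearMap) (listSum l)
            = listSum (l.map fun p => (f p.1, g p.2)) := by
          induction l with
          | nil => exact LinearMap.map_zero _
          | cons p l ih =>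
              have h2 : (listSum (p :: l) : PTensor E F) = tmul p.1 p.2 + listSum l := rfl
              rw [h2, LinearMap.map_add, ih]
              rfl
        rw [h1]
        refine (norm_le_listCost _).trans ?_
        rw [listCost, listCost, List.map_map, ← List.sum_map_mul_left]
        refine List.sum_le_sum fun p _ => ?_
        calc ‖f p.1‖ * ‖g p.2‖ ≤ (‖f‖ * ‖p.1‖) * (‖g‖ * ‖p.2‖) :=
              mul_le_mul (f.le_opNorm _) (g.le_opNorm _) (norm_nonneg _) (by positivity)
          _ = ‖f‖ * ‖g‖ * (‖p.1‖ * ‖p.2‖) := by ring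
      rcases hc.eq_or_lt with h0 | hpos
      · obtain ⟨l, rfl⟩ := exists_listSum t
        have := key l
        rw [← h0, zero_mul] at this ⊢
        exact this
      · rw [← div_le_iff₀' hpos]
        refine le_norm t fun l hl => ?_
        rw [div_le_iff₀' hpos, ← hl]
        exact key l

theorem map_tmul (f : E →L[ℝ] E') (g : F →L[ℝ] F') (x : E) (y : F) :
    map f g (tmul x y) = tmul (f x) (g y) := rfl

end PTensor

/-- The completed projective tensor product of two real normed spaces. -/
abbrev ProjTensor (E : Type u) (F : Type v) [NormedAddCommGroup E] [NormedSpace ℝ E]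
    [NormedAddCommGroup F] [NormedSpace ℝ F] : Type (max u v) :=
  UniformSpace.Completion (PTensor E F)

/-- The elementary tensor `x ⊗ y` in the completed projective tensor product. -/
def ptmul {E : Type u} {F : Type v} [NormedAddCommGroup E] [NormedSpace ℝ E]
    [NormedAddCommGroup F] [NormedSpace ℝ F] (x : E) (y : F) : ProjTensor E F :=
  ((PTensor.tmul x y : PTensor E F) : UniformSpace.Completion (PTensor E F))

/-- The map `f ⊗ g` between completed projective tensor products. -/
def ptmap {E : Type u} {F : Type v} {E' : Type w} {F' : Type*}
    [NormedAddCommGroup E] [NormedSpace ℝ E] [NormedAddCommGroup F] [NormedSpace ℝ F]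
    [NormedAddCommGroup E'] [NormedSpace ℝ E'] [NormedAddCommGroup F'] [NormedSpace ℝ F']
    (f : E →L[ℝ] E') (g : F →L[ℝ] F') : ProjTensor E F →L[ℝ] ProjTensor E' F' :=
  (PTensor.map f g).completion

theorem ptmap_ptmul {E : Type u} {F : Type v} {E' : Type w} {F' : Type*}
    [NormedAddCommGroup E] [NormedSpace ℝ E] [NormedAddCommGroup F] [NormedSpace ℝ F]
    [NormedAddCommGroup E'] [NormedSpace ℝ E'] [NormedAddCommGroup F'] [NormedSpace ℝ F']
    (f : E →L[ℝ] E') (g : F →L[ℝ] F') (x : E) (y : F) :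
    ptmap f g (ptmul x y) = ptmul (f x) (g y) := by
  unfold ptmap ptmul
  rw [ContinuousLinearMap.completion_apply_coe, PTensor.map_tmul]

/-- `ker β_ℝ` as a subspace of `F(ℝ)`. -/
abbrev kerBeta : Submodule ℝ (FreeSpace ℝ) := LinearMap.ker beta.toLinearMap

/-- The canonical map `ker β_ℝ ⊗̂ F(ℝ) → F(ℝ) ⊗̂ F(ℝ)`. -/
def inclLeft : ProjTensor kerBeta (FreeSpace ℝ) →L[ℝ] ProjTensor (FreeSpace ℝ) (FreeSpace ℝ) :=
  ptmap kerBeta.subtypeL (ContinuousLinearMap.id ℝ (FreeSpace ℝ))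

/-- The canonical map `F(ℝ) ⊗̂ ker β_ℝ → F(ℝ) ⊗̂ F(ℝ)`. -/
def inclRight : ProjTensor (FreeSpace ℝ) kerBeta →L[ℝ] ProjTensor (FreeSpace ℝ) (FreeSpace ℝ) :=
  ptmap (ContinuousLinearMap.id ℝ (FreeSpace ℝ)) kerBeta.subtypeL

/-- The subspace `ker β_ℝ ⊗̂ F(ℝ) + F(ℝ) ⊗̂ ker β_ℝ` of `F(ℝ) ⊗̂ F(ℝ)`, with the induced norm. -/
def predual : Submodule ℝ (ProjTensor (FreeSpace ℝ) (FreeSpace ℝ)) :=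
  LinearMap.range inclLeft.toLinearMap ⊔ LinearMap.range inclRight.toLinearMap

/-! ## Two-Lipschitz maps -/

section BLip

variable (X : Type u) (Y : Type v) (E : Type w) [NormedAddCommGroup X] [NormedAddCommGroup Y]
  [NormedAddCommGroup E] [NormedSpace ℝ E]

/-- Two-Lipschitz maps that vanish on both axes, as a subspace of all maps `X → Y → E`. -/
def blip0Submodule : Submodule ℝ (X → Y → E) where
  carrier := {T | (∃ k : ℝ, 0 < k ∧ ∀ x x' y y',
      ‖T x y - T x' y - T x y' + T x' y'‖ ≤ k * (‖x - x'‖ * ‖y - y'‖)) ∧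
    (∀ x, T x 0 = 0) ∧ ∀ y, T 0 y = 0}
  zero_mem' := ⟨⟨1, one_pos, fun x x' y y' => by simp; positivity⟩, fun _ => rfl, fun _ => rfl⟩
  add_mem' := by
    rintro S T ⟨⟨k, hk, hS⟩, hS1, hS2⟩ ⟨⟨l, hl, hT⟩, hT1, hT2⟩
    refine ⟨⟨k + l, by positivity, fun x x' y y' => ?_⟩, fun x => by simp [hS1, hT1],
      fun y => by simp [hS2, hT2]⟩
    calc ‖(S + T) x y - (S + T) x' y - (S + T) x y' + (S + T) x' y'‖
        = ‖(S x y - S x' y - S x y' + S x' y') + (T x y - T x' y - T x y' + T x' y')‖ := by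
          simp only [Pi.add_apply]; congr 1; abel
      _ ≤ _ := norm_add_le _ _
      _ ≤ (k + l) * (‖x - x'‖ * ‖y - y'‖) := by linarith [hS x x' y y', hT x x' y y']
  smul_mem' := by
    rintro c T ⟨⟨k, hk, hT⟩, hT1, hT2⟩
    refine ⟨⟨|c| * k + 1, by positivity, fun x x' y y' => ?_⟩, fun x => by simp [hT1],
      fun y => by simp [hT2]⟩
    calc ‖(c • T) x y - (c • T) x' y - (c • T) x y' + (c • T) x' y'‖
        = |c| * ‖T x y - T x' y - T x y' + T x' y'‖ := by
          simp only [Pi.smul_apply, ← smul_sub, ← smul_add, norm_smul, Real.norm_eq_abs]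
      _ ≤ |c| * (k * (‖x - x'‖ * ‖y - y'‖)) :=
          mul_le_mul_of_nonneg_left (hT x x' y y') (abs_nonneg c)
      _ ≤ (|c| * k + 1) * (‖x - x'‖ * ‖y - y'‖) := by
          have : 0 ≤ ‖x - x'‖ * ‖y - y'‖ := by positivity
          linarith

/-- The space `BLip₀(X, Y; E)`. It is a type of its own so that it does not inherit the topology of
pointwise convergence. -/
def BLip0 : Type (max u v w) := ↥(blip0Submodule X Y E)

end BLip

namespace BLip0

variable {X : Type u} {Y : Type v} {E : Type w} [NormedAddCommGroup X] [NormedAddCommGroup Y]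
  [NormedAddCommGroup E] [NormedSpace ℝ E]

instance : AddCommGroup (BLip0 X Y E) := inferInstanceAs (AddCommGroup ↥(blip0Submodule X Y E))
instance : Module ℝ (BLip0 X Y E) := inferInstanceAs (Module ℝ ↥(blip0Submodule X Y E))
instance : CoeFun (BLip0 X Y E) (fun _ => X → Y → E) := ⟨fun T => T.1⟩

/-- The second difference `T(x,y) - T(x',y) - T(x,y') + T(x',y')`. -/
def diff (T : BLip0 X Y E) (x x' : X) (y y' : Y) : E := T x y - T x' y - T x y' + T x' y'

/-- The norm `BLip(T)`, the supremum of
`‖T(x,y) - T(x',y) - T(x,y') + T(x',y')‖ / (‖x - x'‖ ‖y - y'‖)`; quadruples with `x = x'` or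
`y = y'` contribute the value `0` and so do not change the supremum. -/
instance : Norm (BLip0 X Y E) :=
  ⟨fun T => ⨆ q : (X × X) × (Y × Y),
    ‖T.diff q.1.1 q.1.2 q.2.1 q.2.2‖ / (‖q.1.1 - q.1.2‖ * ‖q.2.1 - q.2.2‖)⟩

theorem bddAbove (T : BLip0 X Y E) : BddAbove (range fun q : (X × X) × (Y × Y) =>
    ‖T.diff q.1.1 q.1.2 q.2.1 q.2.2‖ / (‖q.1.1 - q.1.2‖ * ‖q.2.1 - q.2.2‖)) := by
  obtain ⟨k, hk, hT⟩ := T.2.1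
  refine ⟨k, ?_⟩
  rintro _ ⟨q, rfl⟩
  exact div_le_of_le_mul₀ (by positivity) hk.le (hT _ _ _ _)

theorem norm_nonneg' (T : BLip0 X Y E) : 0 ≤ ‖T‖ :=
  Real.iSup_nonneg fun _ => by positivity

theorem diff_add (S T : BLip0 X Y E) (x x' : X) (y y' : Y) :
    (S + T).diff x x' y y' = S.diff x x' y y' + T.diff x x' y y' := by
  have h : ∀ a b, (S + T) a b = S a b + T a b := fun _ _ => rfl
  simp only [diff, h]; abel

theorem diff_smul (c : ℝ) (T : BLip0 X Y E) (x x' : X) (y y' : Y) :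
    (c • T).diff x x' y y' = c • T.diff x x' y y' := by
  have h : ∀ a b, (c • T) a b = c • T a b := fun _ _ => rfl
  simp only [diff, h, smul_sub, smul_add]

theorem le_norm (T : BLip0 X Y E) (x x' : X) (y y' : Y) :
    ‖T.diff x x' y y'‖ ≤ ‖T‖ * (‖x - x'‖ * ‖y - y'‖) := by
  rcases eq_or_ne x x' with rfl | hx
  · simp [diff]
  rcases eq_or_ne y y' with rfl | hy
  · simp [diff]
  · have hp : 0 < ‖x - x'‖ * ‖y - y'‖ :=
      mul_pos (norm_pos_iff.2 (sub_ne_zero.2 hx)) (norm_pos_iff.2 (sub_ne_zero.2 hy))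
    exact (div_le_iff₀ hp).1 (le_ciSup T.bddAbove ((x, x'), (y, y')))

theorem norm_le (T : BLip0 X Y E) {k : ℝ} (hk : 0 ≤ k)
    (h : ∀ x x' y y', ‖T.diff x x' y y'‖ ≤ k * (‖x - x'‖ * ‖y - y'‖)) : ‖T‖ ≤ k :=
  ciSup_le fun q => div_le_of_le_mul₀ (by positivity) hk (h _ _ _ _)

theorem norm_smul_le' (c : ℝ) (T : BLip0 X Y E) : ‖c • T‖ ≤ |c| * ‖T‖ := by
  refine norm_le _ (mul_nonneg (abs_nonneg c) T.norm_nonneg') fun x x' y y' => ?_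
  rw [diff_smul, norm_smul, Real.norm_eq_abs, mul_assoc]
  exact mul_le_mul_of_nonneg_left (T.le_norm x x' y y') (abs_nonneg c)

theorem norm_add_le' (S T : BLip0 X Y E) : ‖S + T‖ ≤ ‖S‖ + ‖T‖ := by
  refine norm_le _ (add_nonneg S.norm_nonneg' T.norm_nonneg') fun x x' y y' => ?_
  rw [diff_add]
  linarith [norm_add_le (S.diff x x' y y') (T.diff x x' y y'), S.le_norm x x' y y',
    T.le_norm x x' y y']

theorem eq_zero_of_norm (T : BLip0 X Y E) (h : ‖T‖ = 0) : T = 0 := by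
  refine Subtype.ext (funext fun x => funext fun y => ?_)
  have h1 := T.le_norm x 0 y 0
  rw [h, zero_mul, diff, T.2.2.1, T.2.2.1, T.2.2.2, sub_zero, sub_zero, add_zero] at h1
  exact norm_le_zero_iff.1 h1

theorem core : NormedSpace.Core ℝ (BLip0 X Y E) where
  norm_nonneg := norm_nonneg'
  norm_smul c T := by
    refine le_antisymm (norm_smul_le' c T) ?_
    rcases eq_or_ne c 0 with rfl | hc
    · simpa using norm_nonneg' ((0 : ℝ) • T)
    · have h := norm_smul_le' c⁻¹ (c • T)
      rw [inv_smul_smul₀ hc, abs_inv] at h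
      rw [Real.norm_eq_abs]
      have hc' : 0 < |c| := abs_pos.2 hc
      calc |c| * ‖T‖ ≤ |c| * (|c|⁻¹ * ‖c • T‖) := mul_le_mul_of_nonneg_left h hc'.le
        _ = ‖c • T‖ := by field_simp
  norm_triangle := norm_add_le'
  norm_eq_zero_iff T := by
    refine ⟨eq_zero_of_norm T, ?_⟩
    rintro rfl
    exact le_antisymm (by simpa using norm_smul_le' 0 (0 : BLip0 X Y E)) (norm_nonneg' _)

instance : NormedAddCommGroup (BLip0 X Y E) := NormedAddCommGroup.ofCore core
instance : NormedSpace ℝ (BLip0 X Y E) := NormedSpace.ofCore core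

end BLip0

/-- The bounded bilinear maps `Blin(X, Y; E)`, as a subspace of `BLip₀(X, Y; E)`. -/
def Blin (X : Type u) (Y : Type v) (E : Type w) [NormedAddCommGroup X] [NormedSpace ℝ X]
    [NormedAddCommGroup Y] [NormedSpace ℝ Y] [NormedAddCommGroup E] [NormedSpace ℝ E] :
    Submodule ℝ (BLip0 X Y E) where
  carrier := {T | ∃ B : X →L[ℝ] Y →L[ℝ] E, ∀ x y, T x y = B x y}
  zero_mem' := ⟨0, fun _ _ => rfl⟩
  add_mem' := by
    rintro S T ⟨A, hA⟩ ⟨B, hB⟩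
    refine ⟨A + B, fun x y => ?_⟩
    change S x y + T x y = _
    rw [hA, hB]; rfl
  smul_mem' := by
    rintro c T ⟨B, hB⟩
    refine ⟨c • B, fun x y => ?_⟩
    change c • T x y = _
    rw [hB]; rfl

/-! ## The Lebesgue spaces -/

/-- `L¹(ℝ)` for Lebesgue measure. -/
abbrev L1 : Type := Lp ℝ 1 (volume : Measure ℝ)

/-- `L¹(ℝ²)` for the product Lebesgue measure. -/
abbrev L1Sq : Type := Lp ℝ 1 (volume : Measure (ℝ × ℝ))

/-- `L^∞(ℝ × ℝ)` for the product Lebesgue measure. -/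
abbrev LInfSq : Type := Lp ℝ ∞ (volume : Measure (ℝ × ℝ))

/-- The class of the constant function `1` in `L^∞(ℝ × ℝ)`. -/
def oneInf : LInfSq := (memLp_top_const (1 : ℝ)).toLp (fun _ : ℝ × ℝ => (1 : ℝ))

/-- The constants in `L^∞(ℝ × ℝ)`. -/
abbrev constInf : Submodule ℝ LInfSq := Submodule.span ℝ {oneInf}

/-- The functions in `L¹(ℝ)` with integral zero. -/
def L1Zero : Submodule ℝ L1 where
  carrier := {f | ∫ x, f x = 0}
  zero_mem' := by
    change ∫ x, (0 : L1) x = 0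
    rw [integral_congr_ae (Lp.coeFn_zero ℝ 1 volume)]
    simp
  add_mem' := by
    intro f g hf hg
    change ∫ x, (f + g : L1) x = 0
    rw [integral_congr_ae (Lp.coeFn_add f g)]
    have h := integral_add (L1.integrable_coeFn f) (L1.integrable_coeFn g)
    simp only [Pi.add_apply]
    rw [h, show ∫ x, f x = 0 from hf, show ∫ x, g x = 0 from hg, add_zero]
  smul_mem' := by
    intro c f hf
    change ∫ x, (c • f : L1) x = 0
    rw [integral_congr_ae (Lp.coeFn_smul c f)]
    simp only [Pi.smul_apply]
    rw [integral_smul, show ∫ x, f x = 0 from hf, smul_zero]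

theorem ae_swap {p : ℝ × ℝ → Prop} (h : ∀ᵐ z : ℝ × ℝ, p z) :
    ∀ᵐ y : ℝ, ∀ᵐ x : ℝ, p (x, y) := by
  have h' : ∀ᵐ z : ℝ × ℝ, p z.swap :=
    (Measure.measurePreserving_swap (μ := (volume : Measure ℝ))
      (ν := (volume : Measure ℝ))).quasiMeasurePreserving.ae h
  exact Measure.ae_ae_of_ae_prod h'

/-- The functions `f ∈ L¹(ℝ²)` with `∫ f(x, y) dx = 0` for almost every `y`. -/
def zeroX : Submodule ℝ L1Sq where
  carrier := {f | ∀ᵐ y : ℝ, ∫ x : ℝ, f (x, y) = 0}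
  zero_mem' := by
    filter_upwards [ae_swap (Lp.coeFn_zero ℝ 1 (volume : Measure (ℝ × ℝ)))] with y hy
    rw [integral_congr_ae hy]; simp
  add_mem' := by
    intro f g hf hg
    filter_upwards [hf, hg, ae_swap (Lp.coeFn_add f g),
      (L1.integrable_coeFn f).prod_left_ae, (L1.integrable_coeFn g).prod_left_ae]
      with y h1 h2 h3 h4 h5
    rw [integral_congr_ae h3]
    simp only [Pi.add_apply]
    rw [integral_add h4 h5, h1, h2, add_zero]
  smul_mem' := by
    intro c f hf
    filter_upwards [hf, ae_swap (Lp.coeFn_smul c f)] with y h1 h3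
    rw [integral_congr_ae h3]
    simp only [Pi.smul_apply]
    rw [integral_smul, h1, smul_zero]

/-- The functions `f ∈ L¹(ℝ²)` with `∫ f(x, y) dy = 0` for almost every `x`. -/
def zeroY : Submodule ℝ L1Sq where
  carrier := {f | ∀ᵐ x : ℝ, ∫ y : ℝ, f (x, y) = 0}
  zero_mem' := by
    filter_upwards [Measure.ae_ae_of_ae_prod
      (Lp.coeFn_zero ℝ 1 (volume : Measure (ℝ × ℝ)))] with x hx
    rw [integral_congr_ae hx]; simp
  add_mem' := by
    intro f g hf hg
    filter_upwards [hf, hg, Measure.ae_ae_of_ae_prod (Lp.coeFn_add f g),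
      (L1.integrable_coeFn f).prod_right_ae, (L1.integrable_coeFn g).prod_right_ae]
      with x h1 h2 h3 h4 h5
    rw [integral_congr_ae h3]
    simp only [Pi.add_apply]
    rw [integral_add h4 h5, h1, h2, add_zero]
  smul_mem' := by
    intro c f hf
    filter_upwards [hf, Measure.ae_ae_of_ae_prod (Lp.coeFn_smul c f)] with x h1 h3
    rw [integral_congr_ae h3]
    simp only [Pi.smul_apply]
    rw [integral_smul, h1, smul_zero]

end TwoLip

end

/-!
The statement reduces to the description of `F(ℝ)` and of `F(ℝ) ⊗̂ F(ℝ)` as `L¹`-spaces; the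
rest is duality.

`F(ℝ) = L¹(ℝ)`: a function in `Lip₀(ℝ)` is the primitive of its bounded derivative, so
`h ↦ (f ↦ ∫ f' h)` maps `L¹(ℝ)` isometrically into `Lip₀(ℝ)^*` (`l1ToDual`). It sends the signed
indicator of the interval from `0` to `x` to `δ_x`. By Lebesgue differentiation, a bounded function
whose integrals over all these intervals vanish is zero, so these indicators span a dense subspace
of `L¹(ℝ)`, and the image is exactly `F(ℝ)` (`freeEquiv`). Under this identification `β` is the
integral.

`F(ℝ) ⊗̂ F(ℝ) = L¹(ℝ²)`: for a space `E` isometric to a subspace of `L¹(ℝ)`, the map from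
`E ⊗̂ L¹(ℝ)` to `L¹(ℝ²)` is isometric (`norm_tensorMap`). The set function
`A ↦ (x ↦ x ⊗ 1_A)` extends to a contraction from the Bochner space `L¹(ℝ; E)` to `E ⊗̂ L¹(ℝ)` with
dense range, and the composition with `E ⊗̂ L¹(ℝ) → L¹(ℝ²)` preserves the norm by Fubini, because it
sends a simple function `f` to `(s, t) ↦ f(t)(s)`. With `E = F(ℝ)` this gives `tensorEquiv`; with
`E = ker β` it shows that the canonical map `ker β ⊗̂ F(ℝ) → F(ℝ) ⊗̂ F(ℝ)` is isometric. The range of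
the latter is found from the projection `μ ↦ μ - β(μ) δ₁`: every tensor `ξ` differs from an element
of the range by `δ₁ ⊗ ν`, where `ν` corresponds to the integral of `ξ` over the first variable
(`inclLeft_add_ptmul_delta`). The other summand follows by exchanging the variables.

Duality: a two-Lipschitz map `T` gives the bilinear form `(μ, ν) ↦ ν(y ↦ μ(T(·, y)))`, and this
identifies `BLip₀` with the dual of `F ⊗̂ F` (`linEquiv`). The dual of `L¹` of a σ-finite measure is
`L^∞` (`topDual`), which identifies that dual with `L^∞(ℝ²)` (`infEquiv`). A functional vanishes on
the predual exactly when `Λ(δ_x ⊗ δ_y) = c x y`, that is, when it comes from a bilinear map, or from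
a constant function; the two quotients are then the dual of the predual by the Hahn–Banach theorem
(`quotientDual`).
-/

noncomputable section

namespace TwoLip

/-! ### The projective tensor product and bounded bilinear maps -/

section Projective

variable {E : Type*} {F : Type*} {G : Type*} [NormedAddCommGroup E] [NormedSpace ℝ E]
  [NormedAddCommGroup F] [NormedSpace ℝ F] [NormedAddCommGroup G] [NormedSpace ℝ G]

theorem PTensor.norm_tmul_le (x : E) (y : F) : ‖PTensor.tmul x y‖ ≤ ‖x‖ * ‖y‖ := by
  simpa [PTensor.listSum, PTensor.listCost] using PTensor.norm_le_listCost [(x, y)]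

theorem norm_ptmul_le (x : E) (y : F) : ‖ptmul x y‖ ≤ ‖x‖ * ‖y‖ := by
  unfold ptmul
  rw [UniformSpace.Completion.norm_coe]
  exact PTensor.norm_tmul_le x y

/-- The elementary tensor as a bounded bilinear map into the completed tensor product. -/
def ptmulL (E F : Type*) [NormedAddCommGroup E] [NormedSpace ℝ E]
    [NormedAddCommGroup F] [NormedSpace ℝ F] : E →L[ℝ] F →L[ℝ] ProjTensor E F :=
  LinearMap.mkContinuous₂
    ((TensorProduct.mk ℝ E F).compr₂
      (show E ⊗[ℝ] F →ₗ[ℝ] ProjTensor E F from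
        (UniformSpace.Completion.toComplL (𝕜 := ℝ) (E := PTensor E F)).toLinearMap)) 1
    fun x y => by
      rw [one_mul]
      exact norm_ptmul_le x y

theorem ptmulL_apply (x : E) (y : F) : ptmulL E F x y = ptmul x y := rfl

/-- The elementary tensors span a dense subspace of the completed tensor product. -/
theorem ProjTensor.eq_top_of_ptmul_mem {S : Submodule ℝ (ProjTensor E F)}
    (hS : IsClosed (S : Set (ProjTensor E F))) (h : ∀ x y, ptmul x y ∈ S) : S = ⊤ := by
  refine Submodule.eq_top_iff'.2 fun ξ => ?_
  refine UniformSpace.Completion.induction_on ξ hS fun t => ?_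
  obtain ⟨l, rfl⟩ := PTensor.exists_listSum t
  change UniformSpace.Completion.toComplL (𝕜 := ℝ) (PTensor.listSum l) ∈ S
  rw [PTensor.listSum, map_list_sum, List.map_map]
  refine S.list_sum_mem fun y hy => ?_
  obtain ⟨p, -, rfl⟩ := List.mem_map.1 hy
  exact h p.1 p.2

theorem ProjTensor.ext {f g : ProjTensor E F →L[ℝ] G}
    (h : ∀ x y, f (ptmul x y) = g (ptmul x y)) : f = g := by
  have := ProjTensor.eq_top_of_ptmul_mem (S := LinearMap.ker (f - g).toLinearMap)
    (f - g).isClosed_ker fun x y => sub_eq_zero.2 (h x y)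
  ext ξ
  exact sub_eq_zero.1 (this.ge (Submodule.mem_top (x := ξ)))

/-- The linear map on the algebraic tensor product induced by a bounded bilinear map. -/
def PTensor.lift (B : E →L[ℝ] F →L[ℝ] G) : PTensor E F →ₗ[ℝ] G :=
  show E ⊗[ℝ] F →ₗ[ℝ] G from
    TensorProduct.lift ((ContinuousLinearMap.coeLM ℝ).comp B.toLinearMap)

theorem PTensor.lift_tmul (B : E →L[ℝ] F →L[ℝ] G) (x : E) (y : F) :
    PTensor.lift B (PTensor.tmul x y) = B x y := rfl

theorem PTensor.norm_lift_le (B : E →L[ℝ] F →L[ℝ] G) {C : ℝ} (hC : 0 ≤ C)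
    (hB : ∀ x y, ‖B x y‖ ≤ C * (‖x‖ * ‖y‖)) (t : PTensor E F) :
    ‖PTensor.lift B t‖ ≤ C * ‖t‖ := by
  have key : ∀ l : List (E × F), ‖PTensor.lift B (PTensor.listSum l)‖ ≤ C * PTensor.listCost l := by
    intro l
    induction l with
    | nil => simp [PTensor.listSum, PTensor.listCost]
    | cons p l ih =>
        rw [PTensor.listSum, PTensor.listCost, List.map_cons, List.map_cons, List.sum_cons,
          List.sum_cons, map_add, mul_add, PTensor.lift_tmul]
        exact (norm_add_le _ _).trans (add_le_add (hB _ _) ih)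
  rcases hC.eq_or_lt with rfl | hC'
  · obtain ⟨l, rfl⟩ := PTensor.exists_listSum t
    simpa using key l
  · rw [← div_le_iff₀' hC']
    refine PTensor.le_norm t fun l hl => ?_
    rw [div_le_iff₀' hC', ← hl]
    exact key l

theorem ptlift_bound (B : E →L[ℝ] F →L[ℝ] G) {C : ℝ} (hC : 0 ≤ C)
    (hB : ∀ x y, ‖B x y‖ ≤ C * (‖x‖ * ‖y‖)) (t : PTensor E F) :
    ‖PTensor.lift B t‖
      ≤ C * ‖(UniformSpace.Completion.toComplL (𝕜 := ℝ) (E := PTensor E F)).toLinearMap t‖ := by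
  have h : ‖(UniformSpace.Completion.toComplL (𝕜 := ℝ) (E := PTensor E F)).toLinearMap t‖ = ‖t‖ :=
    UniformSpace.Completion.norm_coe t
  rw [h]
  exact PTensor.norm_lift_le B hC hB t

theorem norm_apply_apply_le (B : E →L[ℝ] F →L[ℝ] G) (x : E) (y : F) :
    ‖B x y‖ ≤ ‖B‖ * (‖x‖ * ‖y‖) :=
  (B.le_opNorm₂ x y).trans_eq (mul_assoc _ _ _)

variable [CompleteSpace G]

/-- The continuous linear map on the completed projective tensor product induced by a bounded
bilinear map. -/
def ptlift (B : E →L[ℝ] F →L[ℝ] G) : ProjTensor E F →L[ℝ] G :=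
  (PTensor.lift B).extendOfNorm
    (UniformSpace.Completion.toComplL (𝕜 := ℝ) (E := PTensor E F)).toLinearMap

theorem ptlift_ptmul (B : E →L[ℝ] F →L[ℝ] G) (x : E) (y : F) :
    ptlift B (ptmul x y) = B x y :=
  LinearMap.extendOfNorm_eq UniformSpace.Completion.denseRange_coe
    ⟨‖B‖, ptlift_bound B (norm_nonneg B) (norm_apply_apply_le B)⟩ (PTensor.tmul x y)

theorem norm_ptlift_apply_le (B : E →L[ℝ] F →L[ℝ] G) {C : ℝ} (hC : 0 ≤ C)
    (hB : ∀ x y, ‖B x y‖ ≤ C * (‖x‖ * ‖y‖)) (ξ : ProjTensor E F) :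
    ‖ptlift B ξ‖ ≤ C * ‖ξ‖ :=
  LinearMap.norm_extendOfNorm_apply_le UniformSpace.Completion.denseRange_coe C
    (ptlift_bound B hC hB) ξ

/-- The exchange of the two factors of the completed tensor product. -/
def ptswap (E F : Type*) [NormedAddCommGroup E] [NormedSpace ℝ E]
    [NormedAddCommGroup F] [NormedSpace ℝ F] : ProjTensor E F →L[ℝ] ProjTensor F E :=
  ptlift (ptmulL F E).flip

theorem ptswap_ptmul (x : E) (y : F) : ptswap E F (ptmul x y) = ptmul y x :=
  ptlift_ptmul _ x y

theorem norm_ptswap_le (ξ : ProjTensor E F) : ‖ptswap E F ξ‖ ≤ ‖ξ‖ := by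
  refine (norm_ptlift_apply_le _ zero_le_one (fun x y => ?_) ξ).trans_eq (one_mul _)
  rw [one_mul, mul_comm]
  exact norm_ptmul_le y x

theorem ptswap_ptswap (ξ : ProjTensor E F) : ptswap F E (ptswap E F ξ) = ξ := by
  have h : (ptswap F E).comp (ptswap E F) = ContinuousLinearMap.id ℝ _ :=
    ProjTensor.ext fun x y => by simp [ptswap_ptmul]
  exact DFunLike.congr_fun h ξ

theorem norm_ptswap (ξ : ProjTensor E F) : ‖ptswap E F ξ‖ = ‖ξ‖ := by
  refine le_antisymm (norm_ptswap_le ξ) ?_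
  conv_lhs => rw [← ptswap_ptswap ξ]
  exact norm_ptswap_le _

end Projective

/-! ### The dual of `L¹` -/

section DualLOne

variable {α : Type*} [MeasurableSpace α] {μ : Measure α}

theorem ae_abs_le_of_abs_setIntegral_le [SigmaFinite μ] {m b : α → ℝ}
    (hm : ∀ s, MeasurableSet s → μ s < ∞ → IntegrableOn m s μ)
    (hb : ∀ s, MeasurableSet s → μ s < ∞ → IntegrableOn b s μ)
    (h : ∀ s, MeasurableSet s → μ s < ∞ → |∫ x in s, m x ∂μ| ≤ ∫ x in s, b x ∂μ) :
    ∀ᵐ x ∂μ, |m x| ≤ b x := by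
  have h1 : 0 ≤ᵐ[μ] fun x => b x - m x :=
    ae_nonneg_of_forall_setIntegral_nonneg_of_sigmaFinite
      (fun s hs hμ => (hb s hs hμ).sub (hm s hs hμ)) fun s hs hμ => by
        rw [integral_sub (hb s hs hμ) (hm s hs hμ), sub_nonneg]
        exact (abs_le.1 (h s hs hμ)).2
  have h2 : 0 ≤ᵐ[μ] fun x => b x + m x :=
    ae_nonneg_of_forall_setIntegral_nonneg_of_sigmaFinite
      (fun s hs hμ => (hb s hs hμ).add (hm s hs hμ)) fun s hs hμ => by
        rw [integral_add (hb s hs hμ) (hm s hs hμ)]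
        linarith [(abs_le.1 (h s hs hμ)).1]
  filter_upwards [h1, h2] with x hx1 hx2
  exact abs_le.2 ⟨by linarith [show 0 ≤ b x + m x from hx2], sub_nonneg.1 hx1⟩

theorem norm_top_le_of_ae_bound {C : ℝ} (hC : 0 ≤ C) (g : Lp ℝ ∞ μ)
    (h : ∀ᵐ x ∂μ, |g x| ≤ C) : ‖g‖ ≤ C := by
  rw [Lp.norm_def, eLpNorm_exponent_top]
  exact ENNReal.toReal_le_of_le_ofReal hC (eLpNormEssSup_le_of_ae_bound h)

theorem ae_abs_le_norm_top (g : Lp ℝ ∞ μ) : ∀ᵐ x ∂μ, |g x| ≤ ‖g‖ := by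
  have h := ae_le_eLpNormEssSup (f := g) (μ := μ)
  filter_upwards [h] with x hx
  have h2 : eLpNormEssSup g μ ≠ ∞ := by
    rw [← eLpNorm_exponent_top]; exact (Lp.memLp g).eLpNorm_ne_top
  have h3 := ENNReal.toReal_mono h2 hx
  rw [Lp.norm_def, eLpNorm_exponent_top]
  simpa using h3

/-- The pairing `(g, f) ↦ ∫ g f` of `L^∞` and `L¹`. -/
def topPairing (μ : Measure α) : Lp ℝ ∞ μ →L[ℝ] StrongDual ℝ (Lp ℝ 1 μ) :=
  (ContinuousLinearMap.mul ℝ ℝ).lpPairing μ ∞ 1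

theorem topPairing_apply (g : Lp ℝ ∞ μ) (f : Lp ℝ 1 μ) :
    topPairing μ g f = ∫ x, g x * f x ∂μ :=
  ContinuousLinearMap.lpPairing_eq_integral _ g f

theorem norm_topPairing_le (g : Lp ℝ ∞ μ) : ‖topPairing μ g‖ ≤ ‖g‖ := by
  refine ContinuousLinearMap.opNorm_le_bound _ (norm_nonneg _) fun f => ?_
  rw [topPairing_apply, L1.norm_eq_integral_norm, ← integral_const_mul]
  refine norm_integral_le_of_norm_le ((L1.integrable_coeFn f).norm.const_mul _) ?_
  filter_upwards [ae_abs_le_norm_top g] with x hx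
  rw [norm_mul]
  exact mul_le_mul_of_nonneg_right hx (norm_nonneg _)

/-- Testing the functional of `g` on indicators of sets `s` gives `|∫_s g| ≤ ‖Λ_g‖ μ(s)`, hence
`|g| ≤ ‖Λ_g‖` almost everywhere. -/
theorem norm_topPairing [SigmaFinite μ] (g : Lp ℝ ∞ μ) : ‖topPairing μ g‖ = ‖g‖ := by
  refine le_antisymm (norm_topPairing_le g) (norm_top_le_of_ae_bound (norm_nonneg _) g ?_)
  have hfin : ∀ s : Set α, MeasurableSet s → μ s < ∞ → IntegrableOn g s μ := fun s _ hμ => by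
    have : IsFiniteMeasure (μ.restrict s) := ⟨by simpa using hμ⟩
    exact ((Lp.memLp g).restrict s).integrable le_top
  refine ae_abs_le_of_abs_setIntegral_le (b := fun _ => ‖topPairing μ g‖) hfin
    (fun s _ hμ => integrableOn_const hμ.ne) fun s hs hμ => ?_
  have h1 := (topPairing μ g).le_opNorm (indicatorConstLp 1 hs hμ.ne (1 : ℝ) : Lp ℝ 1 μ)
  rw [topPairing_apply, norm_indicatorConstLp one_ne_zero ENNReal.one_ne_top] at h1
  have h2 : ∫ x, g x * (indicatorConstLp 1 hs hμ.ne (1 : ℝ) : Lp ℝ 1 μ) x ∂μ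
      = ∫ x in s, g x ∂μ := by
    rw [← integral_indicator hs]
    refine integral_congr_ae ?_
    filter_upwards [indicatorConstLp_coeFn (p := 1) (hs := hs) (hμs := hμ.ne) (c := (1 : ℝ))]
      with x hx
    simp only [hx, indicator]
    split_ifs <;> simp
  rw [h2] at h1
  simpa [measureReal_def, mul_comm] using h1

/-- Truncating `f` where it exceeds `n w` gives an approximation of `f` in `L¹`. -/
theorem tendsto_truncate {f w : α → ℝ} (hf : Integrable f μ) (hw : Measurable w)
    (hpos : ∀ x, 0 < w x) (hfm : StronglyMeasurable f) :
    Filter.Tendsto (fun n : ℕ => ∫ x, |{x | |f x| ≤ n * w x}.indicator f x - f x| ∂μ)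
      Filter.atTop (nhds 0) := by
  have h0 : (0 : ℝ) = ∫ _, (0 : ℝ) ∂μ := by simp
  rw [h0]
  refine tendsto_integral_of_dominated_convergence (fun x => |f x|) (fun n => ?_) hf.abs
    (fun n => Filter.Eventually.of_forall fun x => ?_) (Filter.Eventually.of_forall fun x => ?_)
  · have hs : MeasurableSet {x | |f x| ≤ n * w x} :=
      measurableSet_le hfm.measurable.abs (hw.const_mul _)
    exact ((hf.indicator hs).sub hf).abs.aestronglyMeasurable
  · by_cases hx : x ∈ {x | |f x| ≤ n * w x} <;> simp [hx]
  · obtain ⟨N, hN⟩ := exists_nat_ge (|f x| / w x)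
    refine tendsto_const_nhds.congr' ?_
    filter_upwards [Filter.eventually_ge_atTop N] with n hn
    have hx : x ∈ {x | |f x| ≤ n * w x} := by
      have : |f x| / w x ≤ n := hN.trans (by exact_mod_cast hn)
      exact (div_le_iff₀ (hpos x)).1 this
    simp [indicator_of_mem hx]

theorem exists_pos_integrable [SigmaFinite μ] :
    ∃ w : α → ℝ, (∀ x, 0 < w x) ∧ Measurable w ∧ Integrable w μ := by
  obtain ⟨w, hpos, hm, hi⟩ := exists_pos_lintegral_lt_of_sigmaFinite μ one_ne_zero
  refine ⟨fun x => w x, fun x => by exact_mod_cast hpos x, hm.coe_nnreal_real,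
    hm.coe_nnreal_real.aestronglyMeasurable, ?_⟩
  rw [HasFiniteIntegral]
  simpa using hi.trans ENNReal.one_lt_top

/-- Every bounded functional on `L¹` of a σ-finite measure is integration against a bounded
function. With a weight `v > 0` in `L²`, the functional `h ↦ Λ (v h)` on `L²` is represented by some
`u`, and `Λ` is then integration against `u / v`. -/
theorem topPairing_surjective [SigmaFinite μ] : Function.Surjective (topPairing μ) := by
  intro Λ
  obtain ⟨w, hwpos, hwm, hwi⟩ := exists_pos_integrable (μ := μ)
  set v : α → ℝ := fun x => √(w x) with hv
  have hvpos : ∀ x, 0 < v x := fun x => Real.sqrt_pos.2 (hwpos x)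
  have hvv : ∀ x, v x * v x = w x := fun x => Real.mul_self_sqrt (hwpos x).le
  have hvm : Measurable v := hwm.sqrt
  have hv2 : MemLp v 2 μ := by
    rw [memLp_two_iff_integrable_sq hvm.aestronglyMeasurable]
    simpa [sq, hvv] using hwi
  let M : Lp ℝ 2 μ →L[ℝ] Lp ℝ 1 μ :=
    (ContinuousLinearMap.mul ℝ ℝ).holderL μ 2 2 1 (hv2.toLp v)
  have hM : ∀ h : Lp ℝ 2 μ, M h =ᵐ[μ] fun x => v x * h x := fun h => by
    filter_upwards [(ContinuousLinearMap.mul ℝ ℝ).coeFn_holder (r := 1) (hv2.toLp v) h,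
      hv2.coeFn_toLp] with x hx1 hx2
    rw [← hx2]
    exact hx1
  let u : Lp ℝ 2 μ := (InnerProductSpace.toDual ℝ (Lp ℝ 2 μ)).symm (Λ.comp M)
  have hu : ∀ h : Lp ℝ 2 μ, Λ (M h) = ∫ x, u x * h x ∂μ := fun h => by
    have h1 : inner ℝ u h = Λ (M h) := InnerProductSpace.toDual_symm_apply
    rw [← h1, L2.inner_def]
    exact integral_congr_ae (Filter.Eventually.of_forall fun x => by simp [mul_comm])
  have huv : Integrable (fun x => u x * v x) μ := (Lp.memLp u).integrable_mul hv2
  -- Testing on `1_s v` gives `|∫_s u v| ≤ ‖Λ‖ ∫_s v²`, hence `|u| ≤ ‖Λ‖ v`.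
  have hbound : ∀ᵐ x ∂μ, |u x * v x| ≤ ‖Λ‖ * w x := by
    refine ae_abs_le_of_abs_setIntegral_le (fun s _ _ => huv.integrableOn)
      (fun s _ _ => (hwi.const_mul _).integrableOn) fun s hs hμ => ?_
    have hmem : MemLp (s.indicator v) 2 μ := hv2.indicator hs
    have h1 : Λ (M (hmem.toLp _)) = ∫ x in s, u x * v x ∂μ := by
      rw [hu, ← integral_indicator hs]
      refine integral_congr_ae (hmem.coeFn_toLp.mono fun x hx => ?_)
      simp only [hx, indicator]
      split_ifs <;> simp
    have h2 : ‖M (hmem.toLp _)‖ = ∫ x in s, w x ∂μ := by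
      rw [L1.norm_eq_integral_norm, ← integral_indicator hs]
      refine integral_congr_ae ?_
      filter_upwards [hM (hmem.toLp _), hmem.coeFn_toLp] with x hx1 hx2
      simp only [hx1, hx2, indicator]
      split_ifs
      · rw [hvv, Real.norm_of_nonneg (hwpos x).le]
      · simp
    rw [← h1, integral_const_mul, ← h2]
    exact Λ.le_opNorm _
  have hgb : ∀ᵐ x ∂μ, ‖u x / v x‖ ≤ ‖Λ‖ := by
    filter_upwards [hbound] with x hx
    rw [← hvv, abs_mul, abs_of_pos (hvpos x), ← mul_assoc] at hx
    rw [norm_div, Real.norm_of_nonneg (hvpos x).le, div_le_iff₀ (hvpos x)]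
    exact le_of_mul_le_mul_right hx (hvpos x)
  have hgm : AEStronglyMeasurable (fun x => u x / v x) μ :=
    ((Lp.aestronglyMeasurable u).aemeasurable.div hvm.aemeasurable).aestronglyMeasurable
  have hg : MemLp (fun x => u x / v x) ∞ μ := memLp_top_of_bound hgm ‖Λ‖ hgb
  refine ⟨hg.toLp _, ?_⟩
  have hrange : ∀ h : Lp ℝ 2 μ, topPairing μ (hg.toLp _) (M h) = Λ (M h) := fun h => by
    rw [hu, topPairing_apply]
    refine integral_congr_ae ?_
    filter_upwards [hM h, hg.coeFn_toLp] with x hx1 hx2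
    rw [hx1, hx2]
    field_simp [(hvpos x).ne']
  -- The range of `M` is dense: it contains the truncations `f 1_{|f| ≤ n w}`.
  ext f
  have hfm : StronglyMeasurable f := Lp.stronglyMeasurable f
  have hfi : Integrable f μ := L1.integrable_coeFn f
  let s : ℕ → Set α := fun n => {x | |f x| ≤ n * w x}
  have hs : ∀ n, MeasurableSet (s n) := fun n =>
    measurableSet_le hfm.measurable.abs (hwm.const_mul _)
  have hmem : ∀ n, MemLp (fun x => (s n).indicator f x / v x) 2 μ := fun n => by
    refine MemLp.of_le (hv2.const_mul (n : ℝ))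
      ((hfm.measurable.indicator (hs n)).div hvm).aestronglyMeasurable
      (Filter.Eventually.of_forall fun x => ?_)
    rw [norm_div, norm_mul, Real.norm_of_nonneg (hvpos x).le, div_le_iff₀ (hvpos x), mul_assoc, hvv,
      Real.norm_of_nonneg n.cast_nonneg]
    by_cases hx : x ∈ s n
    · rw [indicator_of_mem hx]; exact hx
    · rw [indicator_of_notMem hx, norm_zero]
      exact mul_nonneg n.cast_nonneg (hwpos x).le
  have hlim : Filter.Tendsto (fun n => M ((hmem n).toLp _)) Filter.atTop (nhds f) := by
    rw [tendsto_iff_norm_sub_tendsto_zero]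
    refine (tendsto_truncate hfi hwm hwpos hfm).congr fun n => ?_
    rw [L1.norm_eq_integral_norm]
    refine integral_congr_ae ?_
    filter_upwards [hM ((hmem n).toLp _), (hmem n).coeFn_toLp,
      Lp.coeFn_sub (M ((hmem n).toLp _)) f] with x hx1 hx2 hx3
    rw [hx3, Pi.sub_apply, hx1, hx2, mul_div_cancel₀ _ (hvpos x).ne', Real.norm_eq_abs]
  refine tendsto_nhds_unique (((topPairing μ (hg.toLp _)).continuous.tendsto f).comp hlim)
    (((Λ.continuous.tendsto f).comp hlim).congr fun n => ?_)
  exact (hrange _).symm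

/-- The isometry of `L^∞` onto the dual of `L¹`. -/
def topDual (μ : Measure α) [SigmaFinite μ] : Lp ℝ ∞ μ ≃ₗᵢ[ℝ] StrongDual ℝ (Lp ℝ 1 μ) :=
  LinearIsometryEquiv.ofSurjective ⟨(topPairing μ).toLinearMap, norm_topPairing⟩
    topPairing_surjective

theorem topDual_apply [SigmaFinite μ] (g : Lp ℝ ∞ μ) (f : Lp ℝ 1 μ) :
    topDual μ g f = ∫ x, g x * f x ∂μ :=
  topPairing_apply g f

/-- A closed subspace of `L¹` is everything if no nonzero bounded function annihilates it. -/
theorem eq_top_of_forall_integral_mul_eq_zero [SigmaFinite μ] {S : Submodule ℝ (Lp ℝ 1 μ)}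
    (hS : IsClosed (S : Set (Lp ℝ 1 μ)))
    (h : ∀ g : Lp ℝ ∞ μ, (∀ f ∈ S, ∫ x, g x * f x ∂μ = 0) → g =ᵐ[μ] 0) : S = ⊤ := by
  by_contra hne
  obtain ⟨f, -, hf⟩ := SetLike.exists_of_lt (lt_top_iff_ne_top.2 hne)
  have hnorm : ‖(Submodule.Quotient.mk f : Lp ℝ 1 μ ⧸ S)‖ ≠ 0 := fun h0 => by
    have := (QuotientAddGroup.norm_mk_eq_zero_iff_mem_closure (S := S.toAddSubgroup)).1 h0
    exact hf (hS.closure_eq.subset this)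
  obtain ⟨l, -, hl⟩ := exists_dual_vector ℝ _ hnorm
  obtain ⟨g, hg⟩ := topPairing_surjective (l.comp S.mkQL)
  have hg0 : g = 0 := Lp.eq_zero_iff_ae_eq_zero.2 (h g fun k hk => by
    rw [← topPairing_apply, hg, ContinuousLinearMap.comp_apply]
    have : S.mkQL k = 0 := (Submodule.Quotient.mk_eq_zero S).2 hk
    rw [this, map_zero])
  have h1 : topPairing μ g f = l (Submodule.Quotient.mk f) := by rw [hg]; rfl
  rw [hg0, map_zero, hl] at h1
  exact hnorm h1.symm

end DualLOne

/-! ### The Lipschitz free space of the line -/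

section FreeSpace

variable {X : Type*} [NormedAddCommGroup X] {G : Type*} [NormedAddCommGroup G] [NormedSpace ℝ G]

theorem FreeSpace.eq_top_of_delta_mem {S : Submodule ℝ (FreeSpace X)}
    (hS : IsClosed (S : Set (FreeSpace X))) (h : ∀ x, delta x ∈ S) : S = ⊤ := by
  have hcl : IsClosed (freeSubmodule X : Set (StrongDual ℝ (Lip0 X))) :=
    Submodule.isClosed_topologicalClosure _
  have hemb : Topology.IsClosedEmbedding (Subtype.val : FreeSpace X → StrongDual ℝ (Lip0 X)) :=
    hcl.isClosedEmbedding_subtypeVal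
  have hle : freeSubmodule X ≤ S.map (FreeSpace.incl X).toLinearMap := by
    refine Submodule.topologicalClosure_minimal _ (Submodule.span_le.2 ?_) (hemb.isClosedMap _ hS)
    rintro _ ⟨x, rfl⟩
    exact ⟨delta x, h x, rfl⟩
  refine Submodule.eq_top_iff'.2 fun μ => ?_
  obtain ⟨ν, hν, he⟩ := hle μ.2
  rwa [show ν = μ from Subtype.ext he] at hν

theorem FreeSpace.ext {f g : FreeSpace X →L[ℝ] G} (h : ∀ x, f (delta x) = g (delta x)) :
    f = g := by
  have := FreeSpace.eq_top_of_delta_mem (S := LinearMap.ker (f - g).toLinearMap)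
    (f - g).isClosed_ker fun x => sub_eq_zero.2 (h x)
  ext μ
  exact sub_eq_zero.1 (this.ge (Submodule.mem_top (x := μ)))

theorem norm_delta_sub_le (x x' : X) : ‖delta x - delta x'‖ ≤ ‖x - x'‖ := by
  change ‖Lip0.eval x - Lip0.eval x'‖ ≤ _
  refine ContinuousLinearMap.opNorm_le_bound _ (norm_nonneg _) fun f => ?_
  rw [mul_comm]
  exact f.le_norm x x'

theorem delta_zero : (delta 0 : FreeSpace X) = 0 :=
  Subtype.ext (ContinuousLinearMap.ext fun f => f.map_zero)

theorem Lip0.lipschitzWith (f : Lip0 X) : LipschitzWith ‖f‖₊ f :=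
  LipschitzWith.of_dist_le_mul fun x y => by
    rw [Real.dist_eq, dist_eq_norm]
    exact f.le_norm x y

/-- A Lipschitz function is absolutely continuous, so it is the primitive of its derivative. -/
theorem Lip0.integral_deriv (f : Lip0 ℝ) (x : ℝ) : ∫ s in (0 : ℝ)..x, deriv f s = f x := by
  rw [((f.lipschitzWith.lipschitzOnWith (s := uIcc 0 x)).absolutelyContinuousOnInterval
    ).integral_deriv_eq_sub, f.map_zero, sub_zero]

theorem Lip0.memLp_deriv (f : Lip0 ℝ) : MemLp (deriv f) ∞ (volume : Measure ℝ) :=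
  memLp_top_of_bound (measurable_deriv f).aestronglyMeasurable ‖f‖
    (Filter.Eventually.of_forall fun _ => norm_deriv_le_of_lipschitz f.lipschitzWith)

/-- Differentiation as a map from `Lip₀(ℝ)` to `L^∞(ℝ)`. A Lipschitz function is differentiable
almost everywhere, so the value `0` of `deriv` at the other points does not matter. -/
def derivInf : Lip0 ℝ →L[ℝ] Lp ℝ ∞ (volume : Measure ℝ) :=
  LinearMap.mkContinuous
    { toFun := fun f => f.memLp_deriv.toLp _
      map_add' := fun f g => by
        rw [← MemLp.toLp_add, MemLp.toLp_eq_toLp_iff]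
        filter_upwards [f.lipschitzWith.ae_differentiableAt_real,
          g.lipschitzWith.ae_differentiableAt_real] with x hf hg
        exact deriv_add hf hg
      map_smul' := fun c f => by
        rw [RingHom.id_apply, ← MemLp.toLp_const_smul, MemLp.toLp_eq_toLp_iff]
        filter_upwards [f.lipschitzWith.ae_differentiableAt_real] with x hf
        exact deriv_const_smul c hf } 1 fun f => by
    rw [one_mul]
    refine norm_top_le_of_ae_bound (norm_nonneg _) _ ?_
    filter_upwards [f.memLp_deriv.coeFn_toLp] with x hx
    change |f.memLp_deriv.toLp _ x| ≤ _
    rw [hx]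
    exact norm_deriv_le_of_lipschitz f.lipschitzWith

theorem coeFn_derivInf (f : Lip0 ℝ) : derivInf f =ᵐ[volume] deriv f := f.memLp_deriv.coeFn_toLp

theorem norm_derivInf_le (f : Lip0 ℝ) : ‖derivInf f‖ ≤ ‖f‖ := by
  refine norm_top_le_of_ae_bound (norm_nonneg _) _ ?_
  filter_upwards [coeFn_derivInf f] with x hx
  rw [hx]
  exact norm_deriv_le_of_lipschitz f.lipschitzWith

theorem locallyIntegrable_top (g : Lp ℝ ∞ (volume : Measure ℝ)) :
    LocallyIntegrable g (volume : Measure ℝ) :=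
  (Lp.memLp g).locallyIntegrable le_top

theorem intervalIntegrable_top (g : Lp ℝ ∞ (volume : Measure ℝ)) (a b : ℝ) :
    IntervalIntegrable g volume a b :=
  ((locallyIntegrable_top g).integrableOn_isCompact isCompact_uIcc).intervalIntegrable

theorem abs_primitive_sub_le (g : Lp ℝ ∞ (volume : Measure ℝ)) (x x' : ℝ) :
    |(∫ s in (0 : ℝ)..x, g s) - ∫ s in (0 : ℝ)..x', g s| ≤ ‖g‖ * ‖x - x'‖ := by
  rw [intervalIntegral.integral_interval_sub_left (intervalIntegrable_top g _ _)
    (intervalIntegrable_top g _ _)]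
  have h : ∀ᵐ s, s ∈ uIoc x' x → ‖g s‖ ≤ ‖g‖ := (ae_abs_le_norm_top g).mono fun _ hs _ => hs
  exact intervalIntegral.norm_integral_le_of_norm_le_const_ae h

/-- The primitive `x ↦ ∫₀ˣ g` of a bounded function. -/
def primitive (g : Lp ℝ ∞ (volume : Measure ℝ)) : Lip0 ℝ :=
  ⟨fun x => ∫ s in (0 : ℝ)..x, g s, ⟨‖g‖, norm_nonneg _, abs_primitive_sub_le g⟩,
    intervalIntegral.integral_same⟩

theorem norm_primitive_le (g : Lp ℝ ∞ (volume : Measure ℝ)) : ‖primitive g‖ ≤ ‖g‖ :=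
  Lip0.norm_le _ (norm_nonneg _) (abs_primitive_sub_le g)

theorem derivInf_primitive (g : Lp ℝ ∞ (volume : Measure ℝ)) : derivInf (primitive g) = g := by
  refine Lp.ext ?_
  filter_upwards [coeFn_derivInf (primitive g),
    LocallyIntegrable.ae_hasDerivAt_integral (locallyIntegrable_top g)] with x hx1 hx2
  rw [hx1]
  exact (hx2 0).deriv

/-- The signed indicator function of the open interval between `0` and `x`: it is `1` on `(0, x)`
if `x > 0`, and `-1` on `(x, 0)` if `x < 0`. -/
def signedIndicator (x : ℝ) : ℝ → ℝ :=
  fun s => (Ioo 0 x).indicator 1 s - (Ioo x 0).indicator 1 s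

theorem integrable_indicator_Ioo (a b : ℝ) :
    Integrable ((Ioo a b).indicator (1 : ℝ → ℝ)) volume :=
  (integrable_indicator_iff measurableSet_Ioo).2 (integrableOn_const (by simp))

theorem memLp_signedIndicator (x : ℝ) : MemLp (signedIndicator x) 1 volume :=
  memLp_one_iff_integrable.2 ((integrable_indicator_Ioo 0 x).sub (integrable_indicator_Ioo x 0))

/-- The class in `L¹(ℝ)` of the signed indicator function of the interval between `0` and `x`. -/
def signedIndicatorL1 (x : ℝ) : L1 := (memLp_signedIndicator x).toLp _

theorem topPairing_signedIndicatorL1 (g : Lp ℝ ∞ (volume : Measure ℝ)) (x : ℝ) :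
    topPairing volume g (signedIndicatorL1 x) = ∫ s in (0 : ℝ)..x, g s := by
  have hi : ∀ a b, Integrable ((Ioo a b).indicator g) volume := fun a b =>
    (integrable_indicator_iff measurableSet_Ioo).2
      (((locallyIntegrable_top g).integrableOn_isCompact isCompact_Icc).mono_set
        Ioo_subset_Icc_self)
  have h : ∫ s, g s * signedIndicatorL1 x s
      = ∫ s, ((Ioo 0 x).indicator g s - (Ioo x 0).indicator g s) := by
    refine integral_congr_ae ?_
    filter_upwards [(memLp_signedIndicator x).coeFn_toLp] with s hs
    change g s * (memLp_signedIndicator x).toLp _ s = _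
    rw [hs]
    simp only [signedIndicator, indicator]
    split_ifs <;> simp
  rw [topPairing_apply, h, integral_sub (hi _ _) (hi _ _), integral_indicator measurableSet_Ioo,
    integral_indicator measurableSet_Ioo, intervalIntegral, integral_Ioc_eq_integral_Ioo,
    integral_Ioc_eq_integral_Ioo]

/-- The map `L¹(ℝ) → Lip₀(ℝ)^*` sending `h` to the functional `f ↦ ∫ f' h`. -/
def l1ToDual : L1 →ₗᵢ[ℝ] StrongDual ℝ (Lip0 ℝ) where
  toLinearMap := (((topPairing volume).comp derivInf).flip).toLinearMap
  norm_map' h := by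
    change ‖((topPairing volume).comp derivInf).flip h‖ = ‖h‖
    refine le_antisymm (ContinuousLinearMap.opNorm_le_bound _ (norm_nonneg _) fun f => ?_) ?_
    · rw [mul_comm]
      refine ((topPairing volume (derivInf f)).le_opNorm h).trans ?_
      gcongr
      exact (norm_topPairing_le _).trans (norm_derivInf_le f)
    · -- A norming functional of `h` is given by a bounded function, the derivative of its primitive.
      obtain ⟨Λ, hΛ, hΛh⟩ := exists_dual_vector'' ℝ h
      obtain ⟨g, rfl⟩ := topPairing_surjective Λ
      rw [norm_topPairing] at hΛ
      have h1 := (((topPairing volume).comp derivInf).flip h).le_opNorm (primitive g)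
      rw [ContinuousLinearMap.flip_apply, ContinuousLinearMap.comp_apply, derivInf_primitive,
        hΛh] at h1
      have h2 : ‖primitive g‖ ≤ 1 := (norm_primitive_le g).trans hΛ
      have h3 : ‖(‖h‖ : ℝ)‖ = ‖h‖ := norm_norm h
      refine h3.symm.le.trans (h1.trans ?_)
      exact mul_le_of_le_one_right (norm_nonneg _) h2

theorem l1ToDual_apply (h : L1) (f : Lip0 ℝ) :
    l1ToDual h f = topPairing volume (derivInf f) h := rfl

theorem l1ToDual_signedIndicatorL1 (x : ℝ) : l1ToDual (signedIndicatorL1 x) = Lip0.eval x := by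
  ext f
  rw [l1ToDual_apply, topPairing_signedIndicatorL1,
    intervalIntegral.integral_congr_ae ((coeFn_derivInf f).mono fun s hs _ => hs),
    f.integral_deriv]
  rfl

/-- The signed indicator functions span a dense subspace of `L¹(ℝ)`. -/
theorem eq_top_of_signedIndicatorL1_mem {S : Submodule ℝ L1} (hS : IsClosed (S : Set L1))
    (h : ∀ x, signedIndicatorL1 x ∈ S) : S = ⊤ := by
  refine eq_top_of_forall_integral_mul_eq_zero hS fun g hg => ?_
  have h0 : ∀ x : ℝ, ∫ s in (0 : ℝ)..x, g s = 0 := fun x => by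
    rw [← topPairing_signedIndicatorL1, topPairing_apply]
    exact hg _ (h x)
  filter_upwards [LocallyIntegrable.ae_hasDerivAt_integral (locallyIntegrable_top g)] with x hx
  have h1 := hx 0
  simp only [h0] at h1
  exact h1.unique (hasDerivAt_const x 0)

theorem l1ToDual_mem (h : L1) : l1ToDual h ∈ freeSubmodule ℝ := by
  have hS : IsClosed ((freeSubmodule ℝ).comap l1ToDual.toLinearMap : Set L1) :=
    (Submodule.isClosed_topologicalClosure _).preimage l1ToDual.continuous
  have := eq_top_of_signedIndicatorL1_mem hS fun x => by
    rw [Submodule.mem_comap]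
    change l1ToDual (signedIndicatorL1 x) ∈ _
    rw [l1ToDual_signedIndicatorL1]
    exact (delta x).2
  exact this.ge (Submodule.mem_top (x := h))

/-- The isometry of `L¹(ℝ)` into `F(ℝ)` sending `h` to `f ↦ ∫ f' h`. -/
def l1ToFree : L1 →ₗᵢ[ℝ] FreeSpace ℝ where
  toLinearMap := LinearMap.codRestrict (freeSubmodule ℝ) l1ToDual.toLinearMap l1ToDual_mem
  norm_map' h := l1ToDual.norm_map h

theorem l1ToFree_signedIndicatorL1 (x : ℝ) : l1ToFree (signedIndicatorL1 x) = delta x :=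
  Subtype.ext (l1ToDual_signedIndicatorL1 x)

theorem l1ToFree_surjective : Function.Surjective l1ToFree := by
  have := FreeSpace.eq_top_of_delta_mem (S := LinearMap.range l1ToFree.toLinearMap)
    l1ToFree.isometry.isClosedEmbedding.isClosed_range
    fun x => ⟨signedIndicatorL1 x, l1ToFree_signedIndicatorL1 x⟩
  exact LinearMap.range_eq_top.1 this

/-- The isometry of `F(ℝ)` onto `L¹(ℝ)` sending `δ_x` to the signed indicator function of the
interval between `0` and `x`. -/
def freeEquiv : FreeSpace ℝ ≃ₗᵢ[ℝ] L1 :=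
  (LinearIsometryEquiv.ofSurjective l1ToFree l1ToFree_surjective).symm

theorem freeEquiv_delta (x : ℝ) : freeEquiv (delta x) = signedIndicatorL1 x := by
  rw [← l1ToFree_signedIndicatorL1]
  exact (LinearIsometryEquiv.ofSurjective l1ToFree l1ToFree_surjective).symm_apply_apply _

theorem coeFn_freeEquiv_delta (x : ℝ) : freeEquiv (delta x) =ᵐ[volume]
    fun s => (Ioo 0 x).indicator 1 s - (Ioo x 0).indicator 1 s := by
  rw [freeEquiv_delta]
  exact (memLp_signedIndicator x).coeFn_toLp

theorem integral_signedIndicatorL1 (x : ℝ) : ∫ s, signedIndicatorL1 x s = x := by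
  rw [signedIndicatorL1, integral_congr_ae (memLp_signedIndicator x).coeFn_toLp]
  simp only [signedIndicator]
  rw [integral_sub (integrable_indicator_Ioo 0 x) (integrable_indicator_Ioo x 0),
    integral_indicator_one measurableSet_Ioo, integral_indicator_one measurableSet_Ioo]
  rcases le_total 0 x with hx | hx <;> simp [hx]

/-- Under the identification of `F(ℝ)` with `L¹(ℝ)`, the map `β` is integration. -/
theorem integral_freeEquiv (μ : FreeSpace ℝ) : ∫ s, freeEquiv μ s = beta μ := by
  have h : (L1.integralCLM (α := ℝ) (E := ℝ) (μ := volume)).comp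
      freeEquiv.toContinuousLinearEquiv.toContinuousLinearMap = beta := by
    refine beta_unique _ fun x => ?_
    change L1.integralCLM (freeEquiv (delta x)) = x
    rw [freeEquiv_delta, ← L1.integral_eq, L1.integral_eq_integral, integral_signedIndicatorL1]
  rw [← h, ← L1.integral_eq_integral, L1.integral_eq]
  rfl

end FreeSpace

/-! ### The tensor product of `L¹(ℝ)` with itself -/

section TensorLOne

theorem ae_fst {p : ℝ → Prop} (h : ∀ᵐ x : ℝ, p x) : ∀ᵐ z : ℝ × ℝ, p z.1 :=
  (Measure.quasiMeasurePreserving_fst (μ := (volume : Measure ℝ))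
    (ν := (volume : Measure ℝ))).ae h

theorem ae_snd {p : ℝ → Prop} (h : ∀ᵐ x : ℝ, p x) : ∀ᵐ z : ℝ × ℝ, p z.2 :=
  (Measure.quasiMeasurePreserving_snd (μ := (volume : Measure ℝ))
    (ν := (volume : Measure ℝ))).ae h

theorem memLp_mul_prod (f g : L1) : MemLp (fun p : ℝ × ℝ => f p.1 * g p.2) 1 volume :=
  memLp_one_iff_integrable.2 ((L1.integrable_coeFn f).mul_prod (L1.integrable_coeFn g))

theorem norm_toLp_mul_prod (f g : L1) : ‖(memLp_mul_prod f g).toLp‖ = ‖f‖ * ‖g‖ := by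
  rw [L1.norm_eq_integral_norm, L1.norm_eq_integral_norm, L1.norm_eq_integral_norm,
    ← integral_prod_mul]
  refine integral_congr_ae ((memLp_mul_prod f g).coeFn_toLp.mono fun p hp => ?_)
  simp only [hp, norm_mul]

/-- The bilinear map `(f, g) ↦ f(x) g(y)` from `L¹(ℝ) × L¹(ℝ)` to `L¹(ℝ²)`. -/
def l1Tensor : L1 →L[ℝ] L1 →L[ℝ] L1Sq :=
  LinearMap.mkContinuous₂
    (LinearMap.mk₂ ℝ (fun f g => (memLp_mul_prod f g).toLp)
      (fun f f' g => by
        rw [← MemLp.toLp_add, MemLp.toLp_eq_toLp_iff]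
        filter_upwards [ae_fst (Lp.coeFn_add f f')] with p hp
        simp only [hp, Pi.add_apply, add_mul])
      (fun c f g => by
        rw [← MemLp.toLp_const_smul, MemLp.toLp_eq_toLp_iff]
        filter_upwards [ae_fst (Lp.coeFn_smul c f)] with p hp
        simp only [hp, Pi.smul_apply, smul_eq_mul, mul_assoc])
      (fun f g g' => by
        rw [← MemLp.toLp_add, MemLp.toLp_eq_toLp_iff]
        filter_upwards [ae_snd (Lp.coeFn_add g g')] with p hp
        simp only [hp, Pi.add_apply, mul_add])
      (fun c f g => by
        rw [← MemLp.toLp_const_smul, MemLp.toLp_eq_toLp_iff]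
        filter_upwards [ae_snd (Lp.coeFn_smul c g)] with p hp
        simp only [hp, Pi.smul_apply, smul_eq_mul, mul_left_comm])) 1
    fun f g => by
      rw [one_mul]
      exact (norm_toLp_mul_prod f g).le

theorem coeFn_l1Tensor (f g : L1) :
    l1Tensor f g =ᵐ[volume] fun p : ℝ × ℝ => f p.1 * g p.2 :=
  (memLp_mul_prod f g).coeFn_toLp

theorem norm_l1Tensor (f g : L1) : ‖l1Tensor f g‖ = ‖f‖ * ‖g‖ := norm_toLp_mul_prod f g

theorem signedIndicatorL1_eq_sub (x : ℝ) : signedIndicatorL1 x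
    = indicatorConstLp 1 (s := Ioo 0 x) measurableSet_Ioo (by simp) 1
      - indicatorConstLp 1 (s := Ioo x 0) measurableSet_Ioo (by simp) 1 := by
  exact MemLp.toLp_sub _ _

variable {E F : Type*} [NormedAddCommGroup E] [NormedSpace ℝ E]
  [NormedAddCommGroup F] [NormedSpace ℝ F]

/-- For isometric copies `a` and `b` of `E` and `F` in `L¹(ℝ)`, the map `E ⊗̂ F → L¹(ℝ²)` sending
`x ⊗ y` to `a(x)(s) b(y)(t)`. -/
def tensorMap (a : E →ₗᵢ[ℝ] L1) (b : F →ₗᵢ[ℝ] L1) : ProjTensor E F →L[ℝ] L1Sq :=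
  ptlift (l1Tensor.bilinearComp a.toContinuousLinearMap b.toContinuousLinearMap)

theorem tensorMap_ptmul (a : E →ₗᵢ[ℝ] L1) (b : F →ₗᵢ[ℝ] L1) (x : E) (y : F) :
    tensorMap a b (ptmul x y) = l1Tensor (a x) (b y) :=
  ptlift_ptmul _ x y

theorem norm_tensorMap_le (a : E →ₗᵢ[ℝ] L1) (b : F →ₗᵢ[ℝ] L1) (ξ : ProjTensor E F) :
    ‖tensorMap a b ξ‖ ≤ ‖ξ‖ := by
  refine (norm_ptlift_apply_le _ zero_le_one (fun x y => ?_) ξ).trans_eq (one_mul _)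
  rw [one_mul]
  refine (norm_l1Tensor (a x) (b y)).trans_le ?_
  rw [a.norm_map, b.norm_map]

open scoped Classical in
/-- The set function `A ↦ (x ↦ x ⊗ b⁻¹(1_A))`; it is `0` on sets that are not measurable or have
infinite measure. -/
def indTensor (E : Type*) [NormedAddCommGroup E] [NormedSpace ℝ E] (b : F ≃ₗᵢ[ℝ] L1)
    (s : Set ℝ) : E →L[ℝ] ProjTensor E F :=
  if h : MeasurableSet s ∧ volume s ≠ ∞ then
    (ptmulL E F).flip (b.symm (indicatorConstLp 1 h.1 h.2 1)) else 0

theorem indTensor_apply (b : F ≃ₗᵢ[ℝ] L1) {s : Set ℝ} (hs : MeasurableSet s)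
    (hμ : volume s ≠ ∞) (x : E) :
    indTensor E b s x = ptmul x (b.symm (indicatorConstLp 1 hs hμ 1)) := by
  rw [indTensor, dif_pos ⟨hs, hμ⟩]
  rfl

theorem dominated_indTensor (b : F ≃ₗᵢ[ℝ] L1) :
    DominatedFinMeasAdditive volume (indTensor E b) 1 := by
  refine ⟨fun s t hs ht hμs hμt hst => ?_, fun s hs hμ => ?_⟩
  · ext x
    rw [add_apply, indTensor_apply b hs hμs, indTensor_apply b ht hμt,
      indTensor_apply b (hs.union ht) (by finiteness),
      indicatorConstLp_disjoint_union hs ht hμs hμt hst, map_add, ← ptmulL_apply, map_add]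
    rfl
  · refine ContinuousLinearMap.opNorm_le_bound _ (by positivity) fun x => ?_
    rw [indTensor_apply b hs hμ.ne]
    refine (norm_ptmul_le _ _).trans_eq ?_
    rw [LinearIsometryEquiv.norm_map, norm_indicatorConstLp one_ne_zero ENNReal.one_ne_top]
    simp [measureReal_def, mul_comm]

/-- The contraction `L¹(ℝ; E) → E ⊗̂ F` sending `1_A x` to `x ⊗ b⁻¹(1_A)`, where `b` identifies `F`
with `L¹(ℝ)`. -/
def bochnerToTensor (E : Type*) [NormedAddCommGroup E] [NormedSpace ℝ E] (b : F ≃ₗᵢ[ℝ] L1) :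
    Lp E 1 (volume : Measure ℝ) →L[ℝ] ProjTensor E F :=
  L1.setToL1 (dominated_indTensor b)

theorem norm_bochnerToTensor_le (b : F ≃ₗᵢ[ℝ] L1) (f : Lp E 1 (volume : Measure ℝ)) :
    ‖bochnerToTensor E b f‖ ≤ ‖f‖ :=
  (L1.norm_setToL1_le_mul_norm (dominated_indTensor b) zero_le_one f).trans_eq (one_mul _)

theorem bochnerToTensor_indicatorConstLp (b : F ≃ₗᵢ[ℝ] L1) {s : Set ℝ} (hs : MeasurableSet s)
    (hμ : volume s ≠ ∞) (x : E) :
    bochnerToTensor E b (indicatorConstLp 1 hs hμ x)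
      = ptmul x (b.symm (indicatorConstLp 1 hs hμ 1)) := by
  rw [bochnerToTensor, L1.setToL1_indicatorConstLp, indTensor_apply b hs hμ]

/-- The range contains every `x ⊗ b⁻¹(1_A)`, and the indicators of intervals already span a dense
subspace of `L¹(ℝ)`. -/
theorem denseRange_bochnerToTensor (b : F ≃ₗᵢ[ℝ] L1) : DenseRange (bochnerToTensor E b) := by
  set K := (LinearMap.range (bochnerToTensor E b).toLinearMap).topologicalClosure with hK
  have hKc : IsClosed (K : Set (ProjTensor E F)) := Submodule.isClosed_topologicalClosure _
  have hind : ∀ (x : E) {s : Set ℝ} (hs : MeasurableSet s) (hμ : volume s ≠ ∞),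
      ptmul x (b.symm (indicatorConstLp 1 hs hμ 1)) ∈ K := fun x s hs hμ =>
    Submodule.le_topologicalClosure _ ⟨_, bochnerToTensor_indicatorConstLp b hs hμ x⟩
  have hmul : ∀ x y, ptmul x y ∈ K := fun x y => by
    let m : L1 →L[ℝ] ProjTensor E F :=
      (ptmulL E F x).comp b.symm.toContinuousLinearEquiv.toContinuousLinearMap
    have h := eq_top_of_signedIndicatorL1_mem (S := K.comap m.toLinearMap)
      (hKc.preimage m.continuous) fun t => by
        rw [signedIndicatorL1_eq_sub]
        exact sub_mem (S := Submodule ℝ L1) (hind x _ _) (hind x _ _)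
    have h1 : m (b y) ∈ K := h.ge (Submodule.mem_top (x := b y))
    have h2 : m (b y) = ptmul x y := congrArg (ptmul x) (b.symm_apply_apply y)
    rwa [h2] at h1
  have htop : K = ⊤ := ProjTensor.eq_top_of_ptmul_mem hKc hmul
  intro ξ
  exact htop.ge (Submodule.mem_top (x := ξ))

section BochnerCurry

variable {W : Lp E 1 (volume : Measure ℝ) →L[ℝ] L1Sq} {a : E →ₗᵢ[ℝ] L1}

/-- If `W : L¹(ℝ; E) → L¹(ℝ²)` sends `1_A c` to `a(c) ⊗ 1_A`, then it sends a simple function `f`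
to `(s, t) ↦ a(f(t))(s)`. -/
theorem coeFn_of_map_indicatorConstLp
    (hW : ∀ (c : E) (A : Set ℝ) (hA : MeasurableSet A) (hμ : volume A ≠ ∞),
      W (indicatorConstLp 1 hA hμ c) = l1Tensor (a c) (indicatorConstLp 1 hA hμ 1))
    (f : Lp.simpleFunc E 1 (volume : Measure ℝ)) :
    ∀ᵐ t : ℝ, ∀ᵐ s : ℝ, W f (s, t) = a ((f : Lp E 1 (volume : Measure ℝ)) t) s := by
  induction f using Lp.simpleFunc.induction with
  | hp_pos => exact one_ne_zero
  | hp_ne_top => exact ENNReal.one_ne_top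
  | @indicatorConst c A hA hμ =>
    rw [Lp.simpleFunc.coe_indicatorConst, hW]
    filter_upwards [ae_swap (coeFn_l1Tensor (a c) (indicatorConstLp 1 hA hμ.ne 1)),
      indicatorConstLp_coeFn (p := 1) (hs := hA) (hμs := hμ.ne) (c := (1 : ℝ)),
      indicatorConstLp_coeFn (p := 1) (hs := hA) (hμs := hμ.ne) (c := c)] with t h1 h2 h3
    rw [h3]
    by_cases ht : t ∈ A
    · filter_upwards [h1] with s hs
      rw [hs, h2, indicator_of_mem ht, indicator_of_mem ht, mul_one]
    · rw [indicator_of_notMem ht, map_zero]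
      filter_upwards [h1, Lp.coeFn_zero ℝ 1 (volume : Measure ℝ)] with s hs h0
      rw [hs, h2, indicator_of_notMem ht, mul_zero, h0, Pi.zero_apply]
  | @add f g hf hg _ ihf ihg =>
    have hadd : ∀ f' g' : Lp E 1 (volume : Measure ℝ),
        (∀ᵐ t : ℝ, ∀ᵐ s : ℝ, W f' (s, t) = a (f' t) s) →
        (∀ᵐ t : ℝ, ∀ᵐ s : ℝ, W g' (s, t) = a (g' t) s) →
        ∀ᵐ t : ℝ, ∀ᵐ s : ℝ, W (f' + g') (s, t) = a ((f' + g') t) s := by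
      intro f' g' ihf ihg
      rw [map_add]
      filter_upwards [ihf, ihg, ae_swap (Lp.coeFn_add (W f') (W g')), Lp.coeFn_add f' g']
        with t h1 h2 h3 h4
      rw [h4, Pi.add_apply, map_add]
      filter_upwards [h1, h2, h3, Lp.coeFn_add (a (f' t)) (a (g' t))] with s k1 k2 k3 k4
      rw [k3, k4, Pi.add_apply, Pi.add_apply, k1, k2]
    exact hadd _ _ ihf ihg

theorem norm_eq_integral_integral_norm (f : L1Sq) : ‖f‖ = ∫ t : ℝ, ∫ s : ℝ, ‖f (s, t)‖ := by
  rw [L1.norm_eq_integral_norm]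
  exact integral_prod_symm _ (L1.integrable_coeFn f).norm

/-- By Fubini, such a `W` is isometric on simple functions, hence everywhere. -/
theorem norm_of_map_indicatorConstLp
    (hW : ∀ (c : E) (A : Set ℝ) (hA : MeasurableSet A) (hμ : volume A ≠ ∞),
      W (indicatorConstLp 1 hA hμ c) = l1Tensor (a c) (indicatorConstLp 1 hA hμ 1))
    (f : Lp E 1 (volume : Measure ℝ)) : ‖W f‖ = ‖f‖ := by
  refine (Lp.simpleFunc.denseRange (E := E) (μ := (volume : Measure ℝ))
    ENNReal.one_ne_top).induction_on (p := fun f => ‖W f‖ = ‖f‖) f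
    (isClosed_eq (by fun_prop) (by fun_prop)) fun f => ?_
  rw [norm_eq_integral_integral_norm, L1.norm_eq_integral_norm]
  refine integral_congr_ae ?_
  filter_upwards [coeFn_of_map_indicatorConstLp hW f] with t ht
  rw [← a.norm_map, L1.norm_eq_integral_norm]
  exact integral_congr_ae (ht.mono fun s hs => congrArg norm hs)

end BochnerCurry

theorem norm_tensorMap_bochnerToTensor (a : E →ₗᵢ[ℝ] L1) (b : F ≃ₗᵢ[ℝ] L1)
    (f : Lp E 1 (volume : Measure ℝ)) :
    ‖tensorMap a b.toLinearIsometry (bochnerToTensor E b f)‖ = ‖f‖ := by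
  refine norm_of_map_indicatorConstLp (a := a)
    (W := (tensorMap a b.toLinearIsometry).comp (bochnerToTensor E b)) (fun c A hA hμ => ?_) f
  rw [ContinuousLinearMap.comp_apply, bochnerToTensor_indicatorConstLp, tensorMap_ptmul]
  exact congrArg _ (b.apply_symm_apply _)

/-- `E ⊗̂ L¹(ℝ) → L¹(ℝ²)` is isometric for a subspace `E` of `L¹(ℝ)`: the contraction
`L¹(ℝ; E) → E ⊗̂ L¹(ℝ)` has dense range, and its composition with `E ⊗̂ L¹(ℝ) → L¹(ℝ²)` is
isometric. -/
theorem norm_tensorMap (a : E →ₗᵢ[ℝ] L1) (b : F ≃ₗᵢ[ℝ] L1) (ξ : ProjTensor E F) :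
    ‖tensorMap a b.toLinearIsometry ξ‖ = ‖ξ‖ := by
  refine le_antisymm (norm_tensorMap_le a b.toLinearIsometry ξ) ?_
  refine (denseRange_bochnerToTensor b).induction_on
    (p := fun ξ => ‖ξ‖ ≤ ‖tensorMap a b.toLinearIsometry ξ‖) ξ
    (isClosed_le (by fun_prop) (by fun_prop)) fun f => ?_
  rw [norm_tensorMap_bochnerToTensor]
  exact norm_bochnerToTensor_le b f

/-- An integrable function on the plane is zero if its integral over every rectangle is zero. -/
theorem ae_eq_zero_of_forall_setIntegral_prod_eq_zero {G : ℝ × ℝ → ℝ} (hG : Integrable G)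
    (h : ∀ s t : Set ℝ, MeasurableSet s → MeasurableSet t → ∫ p in s ×ˢ t, G p = 0) :
    G =ᵐ[volume] 0 := by
  refine hG.ae_eq_zero_of_forall_setIntegral_eq_zero fun A hA _ => ?_
  refine MeasurableSpace.induction_on_inter (C := fun A _ => ∫ p in A, G p = 0)
    generateFrom_prod.symm isPiSystem_prod (by simp) ?_ ?_ ?_ A hA
  · rintro - ⟨s, hs, t, ht, rfl⟩
    exact h s t hs ht
  · intro B hB ih
    have h0 : ∫ p, G p = 0 := by
      rw [← setIntegral_univ, ← univ_prod_univ]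
      exact h _ _ .univ .univ
    rw [← integral_add_compl hB hG, ih, zero_add] at h0
    exact h0
  · intro B hd hB ih
    rw [integral_iUnion hB hd hG.integrableOn]
    simp [ih]

/-- The products `f(x) g(y)` span a dense subspace of `L¹(ℝ²)`. -/
theorem eq_top_of_l1Tensor_mem {S : Submodule ℝ L1Sq} (hS : IsClosed (S : Set L1Sq))
    (h : ∀ f g, l1Tensor f g ∈ S) : S = ⊤ := by
  refine eq_top_of_forall_integral_mul_eq_zero hS fun g hg => ?_
  -- The weight `w ⊗ w` makes `g` integrable.
  obtain ⟨w, hpos, -, hw⟩ := exists_pos_integrable (μ := (volume : Measure ℝ))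
  have hint : Integrable (fun p : ℝ × ℝ => g p * (w p.1 * w p.2)) :=
    (hw.mul_prod hw).bdd_mul (Lp.aestronglyMeasurable g) (ae_abs_le_norm_top g)
  have h0 := ae_eq_zero_of_forall_setIntegral_prod_eq_zero hint fun s t hs ht => by
    have hws := memLp_one_iff_integrable.2 (hw.indicator hs)
    have hwt := memLp_one_iff_integrable.2 (hw.indicator ht)
    rw [← hg _ (h (hws.toLp _) (hwt.toLp _)), ← integral_indicator (hs.prod ht)]
    refine integral_congr_ae ?_
    filter_upwards [coeFn_l1Tensor (hws.toLp _) (hwt.toLp _), ae_fst hws.coeFn_toLp,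
      ae_snd hwt.coeFn_toLp] with p h1 h2 h3
    rw [h1, h2, h3]
    by_cases hp1 : p.1 ∈ s <;> by_cases hp2 : p.2 ∈ t <;> simp [indicator, hp1, hp2]
  filter_upwards [h0] with p hp
  exact (mul_eq_zero.1 hp).resolve_right (mul_pos (hpos _) (hpos _)).ne'

theorem tensorMap_surjective (a b : E ≃ₗᵢ[ℝ] L1) :
    Function.Surjective (tensorMap a.toLinearIsometry b.toLinearIsometry) := by
  have hiso : Isometry (tensorMap a.toLinearIsometry b.toLinearIsometry) :=
    AddMonoidHomClass.isometry_of_norm _ (norm_tensorMap a.toLinearIsometry b)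
  refine LinearMap.range_eq_top.1 (eq_top_of_l1Tensor_mem
    (S := LinearMap.range (tensorMap a.toLinearIsometry b.toLinearIsometry).toLinearMap)
    hiso.isClosedEmbedding.isClosed_range fun f g => ⟨ptmul (a.symm f) (b.symm g), ?_⟩)
  change tensorMap a.toLinearIsometry b.toLinearIsometry (ptmul (a.symm f) (b.symm g)) = _
  rw [tensorMap_ptmul]
  change l1Tensor (a (a.symm f)) (b (b.symm g)) = _
  rw [a.apply_symm_apply, b.apply_symm_apply]

/-- The isometry of `F(ℝ) ⊗̂ F(ℝ)` onto `L¹(ℝ²)` that extends the identification of `F(ℝ)` with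
`L¹(ℝ)`, sending `μ ⊗ ν` to the product of the functions of `μ` and `ν`. -/
def tensorEquiv : ProjTensor (FreeSpace ℝ) (FreeSpace ℝ) ≃ₗᵢ[ℝ] L1Sq :=
  LinearIsometryEquiv.ofSurjective
    ⟨(tensorMap freeEquiv.toLinearIsometry freeEquiv.toLinearIsometry).toLinearMap,
      norm_tensorMap freeEquiv.toLinearIsometry freeEquiv⟩
    (tensorMap_surjective freeEquiv freeEquiv)

theorem tensorEquiv_ptmul (μ ν : FreeSpace ℝ) :
    tensorEquiv (ptmul μ ν) = l1Tensor (freeEquiv μ) (freeEquiv ν) :=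
  tensorMap_ptmul _ _ μ ν

end TensorLOne

/-! ### Integration over one variable and the two summands of the predual -/

section Fibre

theorem integrable_integral_left (f : L1Sq) : Integrable fun y : ℝ => ∫ x : ℝ, f (x, y) :=
  Integrable.integral_prod_right (μ := (volume : Measure ℝ)) (ν := (volume : Measure ℝ))
    (L1.integrable_coeFn f)

theorem memLp_integral_left (f : L1Sq) : MemLp (fun y : ℝ => ∫ x : ℝ, f (x, y)) 1 volume :=
  memLp_one_iff_integrable.2 (integrable_integral_left f)

/-- Integration over the first variable, as a map from `L¹(ℝ²)` to `L¹(ℝ)`. -/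
def integralLeft : L1Sq →L[ℝ] L1 :=
  LinearMap.mkContinuous
    { toFun := fun f => (memLp_integral_left f).toLp
      map_add' := fun f g => by
        rw [← MemLp.toLp_add, MemLp.toLp_eq_toLp_iff]
        filter_upwards [ae_swap (Lp.coeFn_add f g), (L1.integrable_coeFn f).prod_left_ae,
          (L1.integrable_coeFn g).prod_left_ae] with y h1 h2 h3
        rw [integral_congr_ae h1]
        exact integral_add h2 h3
      map_smul' := fun c f => by
        rw [RingHom.id_apply, ← MemLp.toLp_const_smul, MemLp.toLp_eq_toLp_iff]
        filter_upwards [ae_swap (Lp.coeFn_smul c f)] with y h1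
        rw [integral_congr_ae h1]
        exact integral_smul c _ } 1 fun f => by
    rw [one_mul, norm_eq_integral_integral_norm, L1.norm_eq_integral_norm]
    refine integral_mono_ae (L1.integrable_coeFn _).norm
      (Integrable.integral_norm_prod_right (μ := (volume : Measure ℝ)) (L1.integrable_coeFn f)) ?_
    filter_upwards [(memLp_integral_left f).coeFn_toLp] with y hy
    change ‖(memLp_integral_left f).toLp _ y‖ ≤ _
    rw [hy]
    exact norm_integral_le_integral_norm _

theorem coeFn_integralLeft (f : L1Sq) :
    integralLeft f =ᵐ[volume] fun y : ℝ => ∫ x : ℝ, f (x, y) :=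
  (memLp_integral_left f).coeFn_toLp

theorem mem_zeroX_iff (f : L1Sq) : f ∈ zeroX ↔ integralLeft f = 0 := by
  rw [Lp.eq_zero_iff_ae_eq_zero]
  constructor
  · intro h
    filter_upwards [show ∀ᵐ y : ℝ, ∫ x : ℝ, f (x, y) = 0 from h, coeFn_integralLeft f]
      with y h1 h2
    rw [h2, h1, Pi.zero_apply]
  · intro h
    change ∀ᵐ y : ℝ, ∫ x : ℝ, f (x, y) = 0
    filter_upwards [h, coeFn_integralLeft f] with y h1 h2
    rw [← h2, h1, Pi.zero_apply]

theorem integralLeft_l1Tensor (f g : L1) : integralLeft (l1Tensor f g) = (∫ x, f x) • g := by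
  refine Lp.ext ?_
  filter_upwards [coeFn_integralLeft (l1Tensor f g), ae_swap (coeFn_l1Tensor f g),
    Lp.coeFn_smul (∫ x, f x) g] with y h1 h2 h3
  rw [h1, h3, integral_congr_ae h2, Pi.smul_apply, smul_eq_mul]
  exact integral_mul_const _ _

theorem measurePreserving_swap : MeasurePreserving (Prod.swap : ℝ × ℝ → ℝ × ℝ) :=
  Measure.measurePreserving_swap (μ := (volume : Measure ℝ)) (ν := (volume : Measure ℝ))

/-- The exchange of the two variables of an integrable function on the plane. -/
def swapL1 : L1Sq →L[ℝ] L1Sq :=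
  (Lp.compMeasurePreservingₗᵢ ℝ Prod.swap measurePreserving_swap).toContinuousLinearMap

theorem coeFn_swapL1 (f : L1Sq) : swapL1 f =ᵐ[volume] fun p : ℝ × ℝ => f p.swap :=
  Lp.coeFn_compMeasurePreserving f measurePreserving_swap

theorem swapL1_l1Tensor (f g : L1) : swapL1 (l1Tensor f g) = l1Tensor g f := by
  refine Lp.ext ?_
  filter_upwards [coeFn_swapL1 (l1Tensor f g), coeFn_l1Tensor g f,
    measurePreserving_swap.quasiMeasurePreserving.ae (coeFn_l1Tensor f g)] with p h1 h2 h3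
  rw [h1, h2, h3, Prod.fst_swap, Prod.snd_swap, mul_comm]

theorem swapL1_mem_zeroX_iff (f : L1Sq) : swapL1 f ∈ zeroX ↔ f ∈ zeroY := by
  have h : ∀ᵐ y : ℝ, ∫ x : ℝ, swapL1 f (x, y) = ∫ x : ℝ, f (y, x) := by
    filter_upwards [ae_swap (coeFn_swapL1 f)] with y hy
    exact integral_congr_ae hy
  change (∀ᵐ y : ℝ, ∫ x : ℝ, swapL1 f (x, y) = 0) ↔ ∀ᵐ x : ℝ, ∫ y : ℝ, f (x, y) = 0
  constructor
  · intro h1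
    filter_upwards [h, h1] with y k k1 using k.symm.trans k1
  · intro h1
    filter_upwards [h, h1] with y k k1 using k.trans k1

theorem tensorEquiv_ptswap (ξ : ProjTensor (FreeSpace ℝ) (FreeSpace ℝ)) :
    tensorEquiv (ptswap _ _ ξ) = swapL1 (tensorEquiv ξ) := by
  have h : tensorEquiv.toContinuousLinearEquiv.toContinuousLinearMap.comp (ptswap _ _)
      = swapL1.comp tensorEquiv.toContinuousLinearEquiv.toContinuousLinearMap :=
    ProjTensor.ext fun μ ν => by
      change tensorEquiv (ptswap _ _ (ptmul μ ν)) = swapL1 (tensorEquiv (ptmul μ ν))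
      rw [ptswap_ptmul, tensorEquiv_ptmul, tensorEquiv_ptmul, swapL1_l1Tensor]
  exact DFunLike.congr_fun h ξ

theorem inclLeft_ptmul (κ : kerBeta) (ν : FreeSpace ℝ) :
    inclLeft (ptmul κ ν) = ptmul (κ : FreeSpace ℝ) ν := ptmap_ptmul _ _ _ _

theorem inclRight_ptmul (μ : FreeSpace ℝ) (κ : kerBeta) :
    inclRight (ptmul μ κ) = ptmul μ (κ : FreeSpace ℝ) := ptmap_ptmul _ _ _ _

theorem ptswap_inclRight (η : ProjTensor (FreeSpace ℝ) kerBeta) :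
    ptswap _ _ (inclRight η) = inclLeft (ptswap _ _ η) := by
  have h : (ptswap _ _).comp inclRight = inclLeft.comp (ptswap _ _) :=
    ProjTensor.ext fun μ κ => by
      simp only [ContinuousLinearMap.comp_apply, inclRight_ptmul, inclLeft_ptmul, ptswap_ptmul]
  exact DFunLike.congr_fun h η

theorem norm_inclLeft (η : ProjTensor kerBeta (FreeSpace ℝ)) : ‖inclLeft η‖ = ‖η‖ := by
  let a : kerBeta →ₗᵢ[ℝ] L1 := freeEquiv.toLinearIsometry.comp kerBeta.subtypeₗᵢ
  have h : tensorEquiv.toContinuousLinearEquiv.toContinuousLinearMap.comp inclLeft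
      = tensorMap a freeEquiv.toLinearIsometry :=
    ProjTensor.ext fun κ ν => by
      change tensorEquiv (inclLeft (ptmul κ ν)) = _
      rw [inclLeft_ptmul, tensorEquiv_ptmul, tensorMap_ptmul]
      rfl
  rw [← tensorEquiv.norm_map, ← norm_tensorMap a freeEquiv, ← h]
  rfl

theorem norm_inclRight (η : ProjTensor (FreeSpace ℝ) kerBeta) : ‖inclRight η‖ = ‖η‖ := by
  rw [← norm_ptswap, ptswap_inclRight, norm_inclLeft, norm_ptswap]

theorem freeEquiv_mem_L1Zero_iff (μ : FreeSpace ℝ) : μ ∈ kerBeta ↔ freeEquiv μ ∈ L1Zero := by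
  change beta μ = 0 ↔ ∫ x, freeEquiv μ x = 0
  rw [integral_freeEquiv]

/-- The projection `μ ↦ μ - β(μ) δ₁` of `F(ℝ)` onto the kernel of `β`. -/
def kerBetaProj : FreeSpace ℝ →L[ℝ] kerBeta :=
  (ContinuousLinearMap.id ℝ (FreeSpace ℝ) - beta.smulRight (delta 1)).codRestrict kerBeta
    fun μ => by
      change beta (μ - beta μ • delta 1) = 0
      rw [map_sub, map_smul, beta_delta, smul_eq_mul, mul_one, sub_self]

theorem coe_kerBetaProj (μ : FreeSpace ℝ) :
    (kerBetaProj μ : FreeSpace ℝ) = μ - beta μ • delta 1 := rfl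

/-- The splitting of `F(ℝ) ⊗̂ F(ℝ)` into `ker β ⊗̂ F(ℝ)` and `δ₁ ⊗ F(ℝ)`; the second component is
integration over the first variable. -/
theorem inclLeft_add_ptmul_delta (ξ : ProjTensor (FreeSpace ℝ) (FreeSpace ℝ)) :
    inclLeft (ptmap kerBetaProj (ContinuousLinearMap.id ℝ (FreeSpace ℝ)) ξ)
      + ptmul (delta 1) (freeEquiv.symm (integralLeft (tensorEquiv ξ))) = ξ := by
  have h : inclLeft.comp (ptmap kerBetaProj (ContinuousLinearMap.id ℝ (FreeSpace ℝ)))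
      + (ptmulL _ _ (delta 1)).comp
        (freeEquiv.symm.toContinuousLinearEquiv.toContinuousLinearMap.comp
          (integralLeft.comp tensorEquiv.toContinuousLinearEquiv.toContinuousLinearMap))
      = ContinuousLinearMap.id ℝ _ :=
    ProjTensor.ext fun μ ν => by
      change inclLeft (ptmap kerBetaProj (ContinuousLinearMap.id ℝ (FreeSpace ℝ)) (ptmul μ ν))
        + ptmulL _ _ (delta 1) (freeEquiv.symm (integralLeft (tensorEquiv (ptmul μ ν)))) = ptmul μ ν
      rw [ptmap_ptmul, inclLeft_ptmul, tensorEquiv_ptmul, integralLeft_l1Tensor,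
        integral_freeEquiv, map_smul, freeEquiv.symm_apply_apply, coe_kerBetaProj, map_smul,
        ← ptmulL_apply, ← ptmulL_apply, map_sub, map_smul]
      exact sub_add_cancel _ _
  exact DFunLike.congr_fun h ξ

/-- If the integral over the first variable vanishes, then so does the second component of the
splitting. -/
theorem mem_range_inclLeft_iff (ξ : ProjTensor (FreeSpace ℝ) (FreeSpace ℝ)) :
    ξ ∈ LinearMap.range inclLeft.toLinearMap ↔ tensorEquiv ξ ∈ zeroX := by
  rw [mem_zeroX_iff]
  constructor
  · rintro ⟨η, rfl⟩
    have h : integralLeft.comp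
        (tensorEquiv.toContinuousLinearEquiv.toContinuousLinearMap.comp inclLeft) = 0 :=
      ProjTensor.ext fun κ ν => by
        change integralLeft (tensorEquiv (inclLeft (ptmul κ ν))) = 0
        rw [inclLeft_ptmul, tensorEquiv_ptmul, integralLeft_l1Tensor, integral_freeEquiv,
          show beta κ = 0 from κ.2, zero_smul]
    exact DFunLike.congr_fun h η
  · intro h
    have h1 := inclLeft_add_ptmul_delta ξ
    rw [h, map_zero, ← ptmulL_apply, map_zero, add_zero] at h1
    exact ⟨_, h1⟩

theorem mem_range_inclRight_iff (ξ : ProjTensor (FreeSpace ℝ) (FreeSpace ℝ)) :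
    ξ ∈ LinearMap.range inclRight.toLinearMap ↔ tensorEquiv ξ ∈ zeroY := by
  rw [← swapL1_mem_zeroX_iff, ← tensorEquiv_ptswap, ← mem_range_inclLeft_iff]
  constructor
  · rintro ⟨η, rfl⟩
    exact ⟨ptswap _ _ η, (ptswap_inclRight η).symm⟩
  · rintro ⟨η, hη⟩
    refine ⟨ptswap _ _ η, ?_⟩
    rw [← ptswap_ptswap ξ, ← show inclLeft η = ptswap _ _ ξ from hη, ← ptswap_ptswap η,
      ← ptswap_inclRight, ptswap_ptswap, ptswap_ptswap]
    rfl

theorem map_range_inclLeft :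
    (LinearMap.range inclLeft.toLinearMap).map tensorEquiv.toLinearEquiv.toLinearMap = zeroX := by
  ext f
  constructor
  · rintro ⟨ξ, hξ, rfl⟩
    exact (mem_range_inclLeft_iff ξ).1 hξ
  · intro hf
    refine ⟨tensorEquiv.symm f, (mem_range_inclLeft_iff _).2 ?_, tensorEquiv.apply_symm_apply f⟩
    rwa [tensorEquiv.apply_symm_apply]

theorem map_range_inclRight :
    (LinearMap.range inclRight.toLinearMap).map tensorEquiv.toLinearEquiv.toLinearMap = zeroY := by
  ext f
  constructor
  · rintro ⟨ξ, hξ, rfl⟩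
    exact (mem_range_inclRight_iff ξ).1 hξ
  · intro hf
    refine ⟨tensorEquiv.symm f, (mem_range_inclRight_iff _).2 ?_, tensorEquiv.apply_symm_apply f⟩
    rwa [tensorEquiv.apply_symm_apply]

end Fibre

/-! ### Linearization of two-Lipschitz maps -/

section Linearization

variable {X Y : Type*} [NormedAddCommGroup X] [NormedAddCommGroup Y]

/-- The Lipschitz function `T(·, y)`. -/
def BLip0.row (T : BLip0 X Y ℝ) (y : Y) : Lip0 X :=
  ⟨fun x => T x y, ⟨‖T‖ * ‖y‖, mul_nonneg (norm_nonneg _) (norm_nonneg _), fun x x' => by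
    have h := T.le_norm x x' y 0
    rw [BLip0.diff, T.2.2.1, T.2.2.1, sub_zero, add_zero, sub_zero, Real.norm_eq_abs] at h
    linarith⟩, T.2.2.2 y⟩

theorem BLip0.norm_row_sub_le (T : BLip0 X Y ℝ) (y y' : Y) :
    ‖T.row y - T.row y'‖ ≤ ‖T‖ * ‖y - y'‖ := by
  refine Lip0.norm_le _ (mul_nonneg (norm_nonneg _) (norm_nonneg _)) fun x x' => ?_
  have h := T.le_norm x x' y y'
  rw [BLip0.diff, Real.norm_eq_abs] at h
  have h1 : ∀ z, (T.row y - T.row y') z = T z y - T z y' := fun _ => rfl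
  rw [h1, h1, mul_assoc, mul_comm ‖y - y'‖]
  convert h using 2
  ring

theorem FreeSpace.abs_incl_apply_le (μ : FreeSpace X) (f : Lip0 X) :
    |FreeSpace.incl X μ f| ≤ ‖μ‖ * ‖f‖ :=
  (FreeSpace.incl X μ).le_opNorm f

theorem BLip0.row_zero (T : BLip0 X Y ℝ) : T.row 0 = 0 :=
  Subtype.ext (funext T.2.2.1)

theorem BLip0.abs_incl_row_sub_le (T : BLip0 X Y ℝ) (μ : FreeSpace X) (y y' : Y) :
    |FreeSpace.incl X μ (T.row y) - FreeSpace.incl X μ (T.row y')| ≤ ‖T‖ * ‖μ‖ * ‖y - y'‖ := by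
  rw [← map_sub]
  refine (FreeSpace.abs_incl_apply_le μ _).trans ?_
  rw [mul_comm ‖T‖, mul_assoc]
  exact mul_le_mul_of_nonneg_left (T.norm_row_sub_le y y') (norm_nonneg _)

/-- The Lipschitz function `y ↦ μ(T(·, y))` attached to `μ ∈ F(X)`. -/
def BLip0.col (T : BLip0 X Y ℝ) (μ : FreeSpace X) : Lip0 Y :=
  ⟨fun y => FreeSpace.incl X μ (T.row y), ⟨‖T‖ * ‖μ‖,
    mul_nonneg (norm_nonneg _) (norm_nonneg _), T.abs_incl_row_sub_le μ⟩, by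
    change FreeSpace.incl X μ (T.row 0) = 0
    rw [T.row_zero, map_zero]⟩

theorem BLip0.norm_col_le (T : BLip0 X Y ℝ) (μ : FreeSpace X) : ‖T.col μ‖ ≤ ‖T‖ * ‖μ‖ :=
  Lip0.norm_le _ (mul_nonneg (norm_nonneg _) (norm_nonneg _)) (T.abs_incl_row_sub_le μ)

theorem BLip0.abs_incl_col_le (T : BLip0 X Y ℝ) (μ : FreeSpace X) (ν : FreeSpace Y) :
    |FreeSpace.incl Y ν (T.col μ)| ≤ ‖T‖ * ‖μ‖ * ‖ν‖ := by
  refine (FreeSpace.abs_incl_apply_le ν _).trans ?_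
  rw [mul_comm]
  exact mul_le_mul_of_nonneg_right (T.norm_col_le μ) (norm_nonneg _)

/-- The bilinear form `(μ, ν) ↦ ν(y ↦ μ(T(·, y)))` on `F(X) × F(Y)`. -/
def BLip0.bilin (T : BLip0 X Y ℝ) : FreeSpace X →L[ℝ] FreeSpace Y →L[ℝ] ℝ :=
  LinearMap.mkContinuous₂
    (LinearMap.mk₂ ℝ (fun μ ν => FreeSpace.incl Y ν (T.col μ))
      (fun μ μ' ν => by
        have h : T.col (μ + μ') = T.col μ + T.col μ' := Subtype.ext (funext fun y => rfl)
        rw [h, map_add])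
      (fun c μ ν => by
        have h : T.col (c • μ) = c • T.col μ := Subtype.ext (funext fun y => rfl)
        rw [h, map_smul])
      (fun μ ν ν' => by rw [map_add]; rfl)
      (fun c μ ν => by rw [map_smul]; rfl)) ‖T‖ T.abs_incl_col_le

/-- Continuous linear maps on `F(X) ⊗̂ F(Y)` are determined by their values on the tensors
`δ_x ⊗ δ_y`. -/
theorem ProjTensor.ext_delta {G : Type*} [NormedAddCommGroup G] [NormedSpace ℝ G]
    {f g : ProjTensor (FreeSpace X) (FreeSpace Y) →L[ℝ] G}
    (h : ∀ x y, f (ptmul (delta x) (delta y)) = g (ptmul (delta x) (delta y))) : f = g := by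
  refine ProjTensor.ext fun μ ν => ?_
  have h1 : ∀ x, f.comp (ptmulL _ _ (delta x)) = g.comp (ptmulL _ _ (delta x)) := fun x =>
    FreeSpace.ext fun y => h x y
  have h2 : f.comp ((ptmulL _ _).flip ν) = g.comp ((ptmulL _ _).flip ν) :=
    FreeSpace.ext fun x => DFunLike.congr_fun (h1 x) ν
  exact DFunLike.congr_fun h2 μ

/-- The linearization of a two-Lipschitz map `T`: the functional with `δ_x ⊗ δ_y ↦ T(x, y)`. -/
def BLip0.lin (T : BLip0 X Y ℝ) : StrongDual ℝ (ProjTensor (FreeSpace X) (FreeSpace Y)) :=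
  ptlift T.bilin

theorem BLip0.lin_delta (T : BLip0 X Y ℝ) (x : X) (y : Y) :
    T.lin (ptmul (delta x) (delta y)) = T x y :=
  ptlift_ptmul T.bilin _ _

theorem BLip0.norm_lin_le (T : BLip0 X Y ℝ) : ‖T.lin‖ ≤ ‖T‖ :=
  ContinuousLinearMap.opNorm_le_bound _ (norm_nonneg _) fun ξ =>
    norm_ptlift_apply_le _ (norm_nonneg _)
      (fun μ ν => (T.abs_incl_col_le μ ν).trans_eq (mul_assoc _ _ _)) ξ

theorem norm_diff_le_of_functional
    (Λ : StrongDual ℝ (ProjTensor (FreeSpace X) (FreeSpace Y))) (x x' : X) (y y' : Y) :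
    ‖Λ (ptmul (delta x) (delta y)) - Λ (ptmul (delta x') (delta y))
      - Λ (ptmul (delta x) (delta y')) + Λ (ptmul (delta x') (delta y'))‖
      ≤ ‖Λ‖ * (‖x - x'‖ * ‖y - y'‖) := by
  have h : Λ (ptmul (delta x - delta x') (delta y - delta y'))
      = Λ (ptmul (delta x) (delta y)) - Λ (ptmul (delta x') (delta y))
      - Λ (ptmul (delta x) (delta y')) + Λ (ptmul (delta x') (delta y')) := by
    simp only [← ptmulL_apply, map_sub, sub_apply]
    ring
  rw [← h]
  refine (Λ.le_opNorm _).trans (mul_le_mul_of_nonneg_left ?_ (norm_nonneg _))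
  refine (norm_ptmul_le _ _).trans ?_
  exact mul_le_mul (norm_delta_sub_le _ _) (norm_delta_sub_le _ _) (norm_nonneg _) (norm_nonneg _)

/-- The two-Lipschitz map `(x, y) ↦ Λ(δ_x ⊗ δ_y)` of a functional `Λ`. -/
def BLip0.ofFunctional (Λ : StrongDual ℝ (ProjTensor (FreeSpace X) (FreeSpace Y))) :
    BLip0 X Y ℝ :=
  ⟨fun x y => Λ (ptmul (delta x) (delta y)), ⟨‖Λ‖ + 1, by positivity, fun x x' y y' =>
    (norm_diff_le_of_functional Λ x x' y y').trans
      (mul_le_mul_of_nonneg_right (by linarith) (by positivity))⟩,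
    fun x => by
      change Λ (ptmul (delta x) (delta 0)) = 0
      rw [delta_zero, ← ptmulL_apply, map_zero, map_zero],
    fun y => by
      change Λ (ptmul (delta 0) (delta y)) = 0
      rw [delta_zero, ← ptmulL_apply, map_zero, zero_apply, map_zero]⟩

theorem BLip0.lin_ofFunctional (Λ : StrongDual ℝ (ProjTensor (FreeSpace X) (FreeSpace Y))) :
    (BLip0.ofFunctional Λ).lin = Λ :=
  ProjTensor.ext_delta fun x y => BLip0.lin_delta _ x y

theorem BLip0.norm_lin (T : BLip0 X Y ℝ) : ‖T.lin‖ = ‖T‖ := by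
  refine le_antisymm T.norm_lin_le (BLip0.norm_le _ (norm_nonneg _) fun x x' y y' => ?_)
  have h := norm_diff_le_of_functional T.lin x x' y y'
  simp only [BLip0.lin_delta] at h
  exact h

/-- The isometry of `BLip₀(X, Y; ℝ)` onto the dual of `F(X) ⊗̂ F(Y)`. -/
def linEquiv (X Y : Type*) [NormedAddCommGroup X] [NormedAddCommGroup Y] :
    BLip0 X Y ℝ ≃ₗᵢ[ℝ] StrongDual ℝ (ProjTensor (FreeSpace X) (FreeSpace Y)) :=
  LinearIsometryEquiv.ofSurjective
    { toFun := BLip0.lin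
      map_add' := fun S T => ProjTensor.ext_delta fun x y => by
        rw [add_apply, BLip0.lin_delta, BLip0.lin_delta, BLip0.lin_delta]
        rfl
      map_smul' := fun c T => ProjTensor.ext_delta fun x y => by
        rw [RingHom.id_apply, smul_apply, BLip0.lin_delta, BLip0.lin_delta]
        rfl
      norm_map' := BLip0.norm_lin }
    fun Λ => ⟨BLip0.ofFunctional Λ, BLip0.lin_ofFunctional Λ⟩

theorem linEquiv_delta (T : BLip0 X Y ℝ) (x : X) (y : Y) :
    linEquiv X Y T (ptmul (delta x) (delta y)) = T x y :=
  T.lin_delta x y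

end Linearization

/-! ### Quotients as duals of subspaces -/

section QuotientDual

variable {G X : Type*} [NormedAddCommGroup G] [NormedSpace ℝ G] [NormedAddCommGroup X]
  [NormedSpace ℝ X]

/-- Every functional on a subspace `D` of `X` is the restriction of the functional of some `g : G`
of the same norm. -/
theorem exists_norm_eq_restrict (e : G ≃ₗᵢ[ℝ] StrongDual ℝ X) {D : Submodule ℝ X}
    (Λ : StrongDual ℝ D) : ∃ g : G, (e g).comp D.subtypeL = Λ ∧ ‖g‖ = ‖Λ‖ := by
  obtain ⟨Λ', hΛ', hn⟩ := exists_extension_norm_eq D Λ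
  refine ⟨e.symm Λ', ?_, by rw [e.symm.norm_map, hn]⟩
  rw [e.apply_symm_apply]
  ext ξ
  exact hΛ' ξ

/-- If `e` identifies `G` with the dual of `X`, and `N` is the annihilator of the subspace `D` of
`X`, then `G ⧸ N` is isometric to the dual of `D`. -/
def quotientDual (e : G ≃ₗᵢ[ℝ] StrongDual ℝ X) {D : Submodule ℝ X} {N : Submodule ℝ G}
    (h : ∀ g, g ∈ N ↔ ∀ ξ ∈ D, e g ξ = 0) : (G ⧸ N) ≃ₗᵢ[ℝ] StrongDual ℝ D :=
  let r : G →ₗ[ℝ] StrongDual ℝ D :=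
    { toFun := fun g => (e g).comp D.subtypeL
      map_add' := fun g g' => by rw [map_add, ContinuousLinearMap.add_comp]
      map_smul' := fun c g => by rw [map_smul, ContinuousLinearMap.smul_comp]; rfl }
  have hr : ∀ g, g ∈ N ↔ r g = 0 := fun g => (h g).trans
    ⟨fun hg => ContinuousLinearMap.ext fun ξ => hg ξ ξ.2,
      fun hg ξ hξ => DFunLike.congr_fun hg (⟨ξ, hξ⟩ : D)⟩
  { toLinearEquiv := LinearEquiv.ofBijective (N.liftQ r fun g hg => (hr g).1 hg)
      ⟨LinearMap.ker_eq_bot.1 (Submodule.ker_liftQ_eq_bot _ _ _ fun g hg => (hr g).2 hg),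
        fun Λ => by
          obtain ⟨g, hg, -⟩ := exists_norm_eq_restrict e Λ
          exact ⟨Submodule.Quotient.mk g, hg⟩⟩
    norm_map' := fun q => by
      refine le_antisymm (le_of_forall_pos_le_add fun ε hε => ?_) ?_
      · obtain ⟨g, rfl, hg⟩ := QuotientAddGroup.exists_norm_mk_lt (S := N.toAddSubgroup) q hε
        refine le_trans ?_ hg.le
        change ‖(e g).comp D.subtypeL‖ ≤ ‖g‖
        rw [← e.norm_map]
        refine ContinuousLinearMap.opNorm_le_bound _ (norm_nonneg _) fun ξ => ?_
        exact (e g).le_opNorm ξ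
      · obtain ⟨g, rfl⟩ := Submodule.Quotient.mk_surjective N q
        obtain ⟨g', hg', hn⟩ := exists_norm_eq_restrict e (r g)
        have hmk : (Submodule.Quotient.mk g : G ⧸ N) = Submodule.Quotient.mk g' := by
          rw [Submodule.Quotient.eq, hr, map_sub, sub_eq_zero]
          exact hg'.symm
        rw [hmk]
        refine (Submodule.Quotient.norm_mk_le N g').trans_eq (hn.trans ?_)
        exact congrArg norm hg'.symm }

theorem quotientDual_mk (e : G ≃ₗᵢ[ℝ] StrongDual ℝ X) {D : Submodule ℝ X} {N : Submodule ℝ G}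
    (h : ∀ g, g ∈ N ↔ ∀ ξ ∈ D, e g ξ = 0) (g : G) (ξ : D) :
    quotientDual e h (Submodule.Quotient.mk g) ξ = e g ξ := rfl

end QuotientDual

/-! ### Bilinear maps, constants and the predual -/

section Predual

/-- The isometry of `L^∞(ℝ²)` onto the dual of `F(ℝ) ⊗̂ F(ℝ)`, sending `g` to integration against
`g` on `L¹(ℝ²)`. -/
def infEquiv : LInfSq ≃ₗᵢ[ℝ] StrongDual ℝ (ProjTensor (FreeSpace ℝ) (FreeSpace ℝ)) :=
  LinearIsometryEquiv.ofSurjective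
    { toFun := fun g => (topDual volume g).comp
        tensorEquiv.toContinuousLinearEquiv.toContinuousLinearMap
      map_add' := fun g g' => by rw [map_add, ContinuousLinearMap.add_comp]
      map_smul' := fun c g => by rw [map_smul, ContinuousLinearMap.smul_comp]; rfl
      norm_map' := fun g =>
        (ContinuousLinearMap.opNorm_comp_linearIsometryEquiv (topDual volume g) tensorEquiv).trans
          ((topDual volume).norm_map g) }
    fun Λ => ⟨(topDual volume).symm
      (Λ.comp tensorEquiv.symm.toContinuousLinearEquiv.toContinuousLinearMap), by
        change ((topDual volume) ((topDual volume).symm _)).comp _ = Λ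
        rw [LinearIsometryEquiv.apply_symm_apply]
        ext ξ
        exact congrArg Λ (tensorEquiv.symm_apply_apply ξ)⟩

theorem infEquiv_apply (g : LInfSq) (ξ : ProjTensor (FreeSpace ℝ) (FreeSpace ℝ)) :
    infEquiv g ξ = ∫ p : ℝ × ℝ, g p * tensorEquiv ξ p :=
  topDual_apply g (tensorEquiv ξ)

theorem infEquiv_oneInf_ptmul (μ ν : FreeSpace ℝ) :
    infEquiv oneInf (ptmul μ ν) = beta μ * beta ν := by
  rw [infEquiv_apply, ← integral_freeEquiv, ← integral_freeEquiv, ← integral_prod_mul,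
    tensorEquiv_ptmul]
  refine integral_congr_ae ?_
  filter_upwards [(memLp_top_const (μ := (volume : Measure (ℝ × ℝ))) (1 : ℝ)).coeFn_toLp,
    coeFn_l1Tensor (freeEquiv μ) (freeEquiv ν)] with p h1 h2
  rw [h2, oneInf, h1, one_mul]

theorem infEquiv_oneInf_eq_zero_of_mem {ξ : ProjTensor (FreeSpace ℝ) (FreeSpace ℝ)}
    (hξ : ξ ∈ predual) : infEquiv oneInf ξ = 0 := by
  have h1 : (infEquiv oneInf).comp inclLeft = 0 := ProjTensor.ext fun κ ν => by
    rw [ContinuousLinearMap.comp_apply, inclLeft_ptmul, infEquiv_oneInf_ptmul,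
      show beta κ = 0 from κ.2, zero_mul, zero_apply]
  have h2 : (infEquiv oneInf).comp inclRight = 0 := ProjTensor.ext fun μ κ => by
    rw [ContinuousLinearMap.comp_apply, inclRight_ptmul, infEquiv_oneInf_ptmul,
      show beta κ = 0 from κ.2, mul_zero, zero_apply]
  have hle : predual ≤ LinearMap.ker (infEquiv oneInf).toLinearMap := by
    refine sup_le ?_ ?_
    · rintro _ ⟨η, rfl⟩
      exact DFunLike.congr_fun h1 η
    · rintro _ ⟨η, rfl⟩
      exact DFunLike.congr_fun h2 η
  exact hle hξ

/-- A functional that vanishes on the predual satisfies `Λ(δ_x ⊗ δ_y) = x y Λ(δ₁ ⊗ δ₁)`, because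
`δ_x - x δ₁` is in the kernel of `β`. -/
theorem apply_delta_of_forall_predual
    {Λ : StrongDual ℝ (ProjTensor (FreeSpace ℝ) (FreeSpace ℝ))}
    (h : ∀ ξ ∈ predual, Λ ξ = 0) (x y : ℝ) :
    Λ (ptmul (delta x) (delta y)) = Λ (ptmul (delta 1) (delta 1)) * (x * y) := by
  have h1 := h _ (Submodule.mem_sup_left
    ⟨ptmul (kerBetaProj (delta x)) (delta y), inclLeft_ptmul _ _⟩)
  have h2 := h _ (Submodule.mem_sup_right
    ⟨ptmul (delta 1) (kerBetaProj (delta y)), inclRight_ptmul _ _⟩)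
  simp only [coe_kerBetaProj, beta_delta, ← ptmulL_apply, map_sub, map_smul, sub_apply,
    smul_apply, smul_eq_mul] at h1 h2
  simp only [ptmulL_apply] at h1 h2
  linear_combination h1 + x * h2

theorem mem_constInf_iff (g : LInfSq) : g ∈ constInf ↔ ∀ ξ ∈ predual, infEquiv g ξ = 0 := by
  constructor
  · intro hg ξ hξ
    obtain ⟨c, rfl⟩ := Submodule.mem_span_singleton.1 hg
    rw [map_smul, smul_apply, infEquiv_oneInf_eq_zero_of_mem hξ, smul_zero]
  · intro h
    refine Submodule.mem_span_singleton.2 ⟨infEquiv g (ptmul (delta 1) (delta 1)), ?_⟩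
    refine infEquiv.injective (ProjTensor.ext_delta fun x y => ?_)
    rw [map_smul, smul_apply, infEquiv_oneInf_ptmul, beta_delta, beta_delta,
      apply_delta_of_forall_predual h x y, smul_eq_mul]

theorem mem_Blin_iff (T : BLip0 ℝ ℝ ℝ) :
    T ∈ Blin ℝ ℝ ℝ ↔ infEquiv.symm (linEquiv ℝ ℝ T) ∈ constInf := by
  constructor
  · rintro ⟨B, hB⟩
    refine Submodule.mem_span_singleton.2 ⟨B 1 1, infEquiv.injective ?_⟩
    rw [infEquiv.apply_symm_apply]
    refine ProjTensor.ext_delta fun x y => ?_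
    rw [map_smul, smul_apply, infEquiv_oneInf_ptmul, beta_delta, beta_delta, linEquiv_delta, hB]
    have h1 : B x y = x * (y * B 1 1) := by
      have hx : B x = x • B 1 := by rw [← map_smul, smul_eq_mul, mul_one]
      have hy : B 1 y = y * B 1 1 := by rw [← smul_eq_mul, ← map_smul, smul_eq_mul, mul_one]
      rw [hx, smul_apply, hy, smul_eq_mul]
    rw [h1, smul_eq_mul]
    ring
  · intro h
    obtain ⟨c, hc⟩ := Submodule.mem_span_singleton.1 h
    refine ⟨c • ContinuousLinearMap.mul ℝ ℝ, fun x y => ?_⟩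
    rw [← linEquiv_delta, ← infEquiv.apply_symm_apply (linEquiv ℝ ℝ T), ← hc, map_smul,
      smul_apply, infEquiv_oneInf_ptmul, beta_delta, beta_delta]
    rfl

theorem mem_Blin_iff_forall_predual (T : BLip0 ℝ ℝ ℝ) :
    T ∈ Blin ℝ ℝ ℝ ↔ ∀ ξ ∈ predual, linEquiv ℝ ℝ T ξ = 0 := by
  rw [mem_Blin_iff, mem_constInf_iff, infEquiv.apply_symm_apply]

end Predual

end TwoLip

end

theorem mainTheorem8 :
    ∃ (φ : TwoLip.FreeSpace ℝ ≃ₗᵢ[ℝ] TwoLip.L1)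
      (Ψ : TwoLip.ProjTensor (TwoLip.FreeSpace ℝ) (TwoLip.FreeSpace ℝ) ≃ₗᵢ[ℝ] TwoLip.L1Sq)
      (Lin : TwoLip.BLip0 ℝ ℝ ℝ ≃ₗᵢ[ℝ]
        StrongDual ℝ (TwoLip.ProjTensor (TwoLip.FreeSpace ℝ) (TwoLip.FreeSpace ℝ)))
      (J : StrongDual ℝ (TwoLip.ProjTensor (TwoLip.FreeSpace ℝ) (TwoLip.FreeSpace ℝ)) ≃ₗᵢ[ℝ]
        TwoLip.LInfSq)
      (Θ : (TwoLip.BLip0 ℝ ℝ ℝ ⧸ TwoLip.Blin ℝ ℝ ℝ) ≃ₗᵢ[ℝ] StrongDual ℝ TwoLip.predual)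
      (Q : (TwoLip.LInfSq ⧸ TwoLip.constInf) ≃ₗᵢ[ℝ] StrongDual ℝ TwoLip.predual),
      -- the identification of the free space with the integrable functions
      (∀ x : ℝ, φ (TwoLip.delta x) =ᵐ[volume]
        fun s => (Ioo 0 x).indicator 1 s - (Ioo x 0).indicator 1 s) ∧
      (∀ μ : TwoLip.FreeSpace ℝ, μ ∈ TwoLip.kerBeta ↔ φ μ ∈ TwoLip.L1Zero) ∧
      -- the induced identification of the tensor product
      (∀ μ ν : TwoLip.FreeSpace ℝ, Ψ (TwoLip.ptmul μ ν) =ᵐ[volume]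
        fun p : ℝ × ℝ => φ μ p.1 * φ ν p.2) ∧
      -- linearization of two-Lipschitz maps, and duality between integrable and bounded functions
      (∀ (T : TwoLip.BLip0 ℝ ℝ ℝ) (x y : ℝ),
        Lin T (TwoLip.ptmul (TwoLip.delta x) (TwoLip.delta y)) = T x y) ∧
      (∀ Λ ξ, Λ ξ = ∫ p : ℝ × ℝ, J Λ p * Ψ ξ p) ∧
      (∀ T : TwoLip.BLip0 ℝ ℝ ℝ, T ∈ TwoLip.Blin ℝ ℝ ℝ ↔ J (Lin T) ∈ TwoLip.constInf) ∧
      -- the two quotients as duals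
      (∀ (T : TwoLip.BLip0 ℝ ℝ ℝ) (ξ : TwoLip.predual),
        Θ (Submodule.Quotient.mk T) ξ = Lin T ξ) ∧
      (∀ (g : TwoLip.LInfSq) (ξ : TwoLip.predual),
        Q (Submodule.Quotient.mk g) ξ = ∫ p : ℝ × ℝ, g p * Ψ ξ p) ∧
      -- the two summands of the predual, and the predual, inside the integrable functions
      Isometry TwoLip.inclLeft ∧ Isometry TwoLip.inclRight ∧
      (LinearMap.range TwoLip.inclLeft.toLinearMap).map Ψ.toLinearEquiv.toLinearMap
        = TwoLip.zeroX ∧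
      (LinearMap.range TwoLip.inclRight.toLinearMap).map Ψ.toLinearEquiv.toLinearMap
        = TwoLip.zeroY ∧
      TwoLip.predual.map Ψ.toLinearEquiv.toLinearMap = TwoLip.zeroX ⊔ TwoLip.zeroY := by
  refine ⟨TwoLip.freeEquiv, TwoLip.tensorEquiv, TwoLip.linEquiv ℝ ℝ, TwoLip.infEquiv.symm,
    TwoLip.quotientDual (TwoLip.linEquiv ℝ ℝ) TwoLip.mem_Blin_iff_forall_predual,
    TwoLip.quotientDual TwoLip.infEquiv TwoLip.mem_constInf_iff,
    TwoLip.coeFn_freeEquiv_delta, TwoLip.freeEquiv_mem_L1Zero_iff, fun μ ν => ?_,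
    TwoLip.linEquiv_delta, fun Λ ξ => ?_, TwoLip.mem_Blin_iff, fun T ξ => rfl, fun g ξ => ?_,
    AddMonoidHomClass.isometry_of_norm _ TwoLip.norm_inclLeft,
    AddMonoidHomClass.isometry_of_norm _ TwoLip.norm_inclRight,
    TwoLip.map_range_inclLeft, TwoLip.map_range_inclRight, ?_⟩
  · rw [TwoLip.tensorEquiv_ptmul]
    exact TwoLip.coeFn_l1Tensor _ _
  · rw [← TwoLip.infEquiv_apply, LinearIsometryEquiv.apply_symm_apply]
  · rw [TwoLip.quotientDual_mk, TwoLip.infEquiv_apply]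
  · rw [TwoLip.predual, Submodule.map_sup, TwoLip.map_range_inclLeft, TwoLip.map_range_inclRight]
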